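/- **Setting.** Let $G=(V,E)$ be a finite simple graph whose vertices are indivisible items, let $N=\{1,\dots,n\}$, $n\ge 1$, be a set of agents, and let all agents have the same additive utility given by $u\colon V\to\mathbb{Z}_{\ge 0}$, so that $u(X)=\sum_{v\in X}u(v)$ for $X\subseteq V$. A set $X\subseteq V$ is *connected* if the induced subgraph $G[X]$ is connected; the empty set counts as connected. A *connected allocation* is a partition $A=(A_1,\dots,A_n)$ of $V$ into pairwise disjoint, possibly empty, connected sets. For a connected set $X\subseteq V$ let $$\mathrm{PMMS}(X)=\max\bigl\{\min\{u(Y),u(Z)\} : Y\sqcup Z=X,\ Y \text{ and } Z \text{ connected}\bigr\}.$$ Agents $i$ and $j$ are *adjacent* under $A$ if some edge of $G$ has one endpoint in $A_i$ and the other in $A_j$. For $\alpha\ge 0$, the allocation $A$ is *$\alpha$-PMMS* if $u(A_i)\ge\alpha\cdot\mathrm{PMMS}(A_i\cup A_j)$ for all distinct agents $i,j$ such that $A_i=\emptyset$ or $i$ and $j$ are adjacent under $A$. **Theorem.** There is an algorithm which, given a connected graph $G=(V,E)$, a number $n\ge 1$ of agents and a utility function $u\colon V\to\mathbb{Z}_{\ge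 0}$ common to all agents, finds a $(3/4)$-PMMS connected allocation of $G$ to the $n$ agents in pseudo-polynomial time, that is, in a number of steps bounded by a polynomial in $|V|$, $n$ and $\max_{v\in V}u(v)$. (Steps are counted on a random access machine on the natural numbers, with addition, truncated subtraction, comparison with zero and indirect memory access at unit cost; the graph is given by its adjacency matrix.) -/

import Mathlib

/-! ### Connected fair division with an identical additive utility -/

namespace ConnectedDivision

variable {V : Type*} [DecidableEq V]

/-- The additive utility of a bundle. -/
def utility (u : V → ℕ) (X : Finset V) : ℕ := ∑ v ∈ X, u v

/-- A bundle is connected if it induces a connected subgraph; the empty bundle counts as connected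
(an agent may receive nothing). -/
def ConnectedBundle (G : SimpleGraph V) (X : Finset V) : Prop :=
  (G.induce (X : Set V)).Preconnected

/-- `Y, Z` is a partition of `X` into two connected bundles. -/
def IsConnectedBipartition (G : SimpleGraph V) (X Y Z : Finset V) : Prop :=
  Disjoint Y Z ∧ Y ∪ Z = X ∧ ConnectedBundle G Y ∧ ConnectedBundle G Z

/-- The pairwise maximin share of `X`: the maximum of `min (u(Y), u(Z))` over all partitions of `X`
into two connected bundles `Y, Z`. (The set is finite, and it is non-empty if `X` is connected,
because of the partition `X, ∅`.) -/
noncomputable def pmms (G : SimpleGraph V) (u : V → ℕ) (X : Finset V) : ℕ :=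
  sSup {r | ∃ Y Z, IsConnectedBipartition G X Y Z ∧ r = min (utility u Y) (utility u Z)}

/-- `A` is an allocation: a partition of all items into (possibly empty) bundles, one per agent. -/
def IsAllocation [Fintype V] {n : ℕ} (A : Fin n → Finset V) : Prop :=
  (∀ i j, i ≠ j → Disjoint (A i) (A j)) ∧ Finset.univ.biUnion A = Finset.univ

/-- An allocation is connected if every bundle is. -/
def IsConnectedAllocation [Fintype V] (G : SimpleGraph V) {n : ℕ} (A : Fin n → Finset V) : Prop :=
  IsAllocation A ∧ ∀ i, ConnectedBundle G (A i)

/-- Agents `i` and `j` are adjacent under `A` if some edge joins their bundles. -/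
def AdjacentUnder (G : SimpleGraph V) {n : ℕ} (A : Fin n → Finset V) (i j : Fin n) : Prop :=
  ∃ v ∈ A i, ∃ w ∈ A j, G.Adj v w

/-- `α`-PMMS for agents with the identical additive utility `u`. -/
def IsApproxPMMS (α : ℝ) (G : SimpleGraph V) (u : V → ℕ) {n : ℕ} (A : Fin n → Finset V) : Prop :=
  ∀ i j, i ≠ j → (A i = ∅ ∨ AdjacentUnder G A i j) →
    α * (pmms G u (A i ∪ A j) : ℝ) ≤ (utility u (A i) : ℝ)

end ConnectedDivision

/-! ### Random access machine programs with a step count -/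

namespace RAM

/-- A machine state: natural-number variables `x₀, x₁, …` and arrays `a₀, a₁, …` of natural numbers,
each with unboundedly many cells. A given program mentions only finitely many of them. -/
structure State where
  var : ℕ → ℕ
  arr : ℕ → ℕ → ℕ

/-- Expressions: constants, variables, array access, addition and truncated subtraction. There is
no multiplication, so that charging one unit of time per operation is polynomially equivalent to
time on a Turing machine. -/
inductive Term : Type
  | const (k : ℕ)
  | var (x : ℕ)
  | get (a : ℕ) (i : Term)
  | add (e f : Term)
  | sub (e f : Term)

/-- The value of an expression. -/
def Term.eval (s : State) : Term → ℕ
  | .const k => k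
  | .var x => s.var x
  | .get a i => s.arr a (i.eval s)
  | .add e f => e.eval s + f.eval s
  | .sub e f => e.eval s - f.eval s

/-- The number of operations needed to evaluate an expression. -/
def Term.cost : Term → ℕ
  | .const _ => 1
  | .var _ => 1
  | .get _ i => i.cost + 1
  | .add e f => e.cost + f.cost + 1
  | .sub e f => e.cost + f.cost + 1

/-- Programs. A test succeeds if the value of its expression is not `0`. -/
inductive Prog : Type
  /-- do nothing -/
  | skip
  /-- `x := e` -/
  | assign (x : ℕ) (e : Term)
  /-- `a[i] := e` -/
  | put (a : ℕ) (i e : Term)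
  /-- `P; Q` -/
  | seq (P Q : Prog)
  /-- `if e then P else Q` -/
  | branch (e : Term) (P Q : Prog)
  /-- `while e do P` -/
  | loop (e : Term) (P : Prog)

/-- Assignment to a variable. -/
def State.setVar (s : State) (x k : ℕ) : State :=
  { s with var := Function.update s.var x k }

/-- Assignment to an array cell. -/
def State.setArr (s : State) (a i k : ℕ) : State :=
  { s with arr := Function.update s.arr a (Function.update (s.arr a) i k) }

/-- `Exec P s s' t`: started in state `s`, the program `P` halts in state `s'` after exactly `t`
steps. -/
inductive Exec : Prog → State → State → ℕ → Prop
  | skip (s : State) : Exec .skip s s 1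
  | assign (x : ℕ) (e : Term) (s : State) :
      Exec (.assign x e) s (s.setVar x (e.eval s)) (e.cost + 1)
  | put (a : ℕ) (i e : Term) (s : State) :
      Exec (.put a i e) s (s.setArr a (i.eval s) (e.eval s)) (i.cost + e.cost + 1)
  | seq {P Q : Prog} {s₁ s₂ s₃ : State} {t₁ t₂ : ℕ} :
      Exec P s₁ s₂ t₁ → Exec Q s₂ s₃ t₂ → Exec (.seq P Q) s₁ s₃ (t₁ + t₂)
  | branchTrue {e : Term} {P Q : Prog} {s s' : State} {t : ℕ} :
      e.eval s ≠ 0 → Exec P s s' t → Exec (.branch e P Q) s s' (e.cost + 1 + t)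
  | branchFalse {e : Term} {P Q : Prog} {s s' : State} {t : ℕ} :
      e.eval s = 0 → Exec Q s s' t → Exec (.branch e P Q) s s' (e.cost + 1 + t)
  | loopTrue {e : Term} {P : Prog} {s₁ s₂ s₃ : State} {t₁ t₂ : ℕ} :
      e.eval s₁ ≠ 0 → Exec P s₁ s₂ t₁ → Exec (.loop e P) s₂ s₃ t₂ →
        Exec (.loop e P) s₁ s₃ (e.cost + 1 + t₁ + t₂)
  | loopFalse {e : Term} {P : Prog} {s : State} :
      e.eval s = 0 → Exec (.loop e P) s s (e.cost + 1)

/-- A search problem, given by its admissible instances, the way an instance is written into memory,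
its size, the largest number occurring in it, and the final memory contents that are correct
answers, is solvable in pseudo-polynomial time if one program solves every admissible instance in
a number of steps that is polynomial in the size and the largest number. -/
def SolvableInPseudoPolyTime {ι : Type*} (admissible : ι → Prop) (input : ι → State)
    (size maxNumber : ι → ℕ) (correct : ι → State → Prop) : Prop :=
  ∃ (P : Prog) (p : Polynomial ℕ), ∀ x : ι, admissible x →
    ∃ (s : State) (t : ℕ), Exec P (input x) s t ∧
      t ≤ p.eval (size x + maxNumber x) ∧ correct x s

end RAM

/-! ### The computational problem -/

namespace ConnectedDivision

/-- An instance: a graph on items `0, …, m - 1`, a number `n` of agents, and the utilities of the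
items, the same for all agents. -/
structure Instance where
  m : ℕ
  n : ℕ
  G : SimpleGraph (Fin m)
  u : Fin m → ℕ

/-- There is at least one agent, and the graph is connected. -/
def Instance.Admissible (I : Instance) : Prop := 0 < I.n ∧ I.G.Connected

/-- The number of items plus the number of agents. -/
def Instance.size (I : Instance) : ℕ := I.m + I.n

/-- The largest utility of an item. -/
def Instance.maxUtility (I : Instance) : ℕ := Finset.univ.sup I.u

open Classical in
/-- The initial memory: `x₀ = m`, `x₁ = n`, the array `a₀` holds the adjacency matrix row by row,
the array `a₁` the utilities, and everything else is `0`. -/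
noncomputable def Instance.input (I : Instance) : RAM.State where
  var := fun x => if x = 0 then I.m else if x = 1 then I.n else 0
  arr := fun a k =>
    if a = 0 then (if ∃ v w : Fin I.m, I.G.Adj v w ∧ k = v * I.m + w then 1 else 0)
    else if a = 1 then (if h : k < I.m then I.u ⟨k, h⟩ else 0)
    else 0

/-- The state `s` holds the allocation `A` in the array `a₂`, whose cell `v` is the index of the
agent who receives item `v`. -/
def Instance.Holds (I : Instance) (s : RAM.State) (A : Fin I.n → Finset (Fin I.m)) : Prop :=
  ∀ (i : Fin I.n) (v : Fin I.m), v ∈ A i ↔ s.arr 2 v = i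

end ConnectedDivision

/-! ### Components of vertex sets -/

/-! The algorithm is a local search. It starts with all items at one agent. For every pair of agents
whose bundles have a connected union X, and for all distinct items a, b of X, it sweeps X from a
towards b: an item z on the boundary of the remaining set Z is passed, Z shrinks to the component of
b in Z - z, and z is chosen so that as many items as possible remain. Every cut tried on the way has
two connected sides, and it is carried out if it raises the smaller of the two utilities. At a fixed
sum, a larger minimum means a smaller sum of squares (`sq_add_sq_lt`), so the sum of squared
utilities is a potential. It is at most N ^ 5, where N is the size plus the largest utility
(`potential_le`); this bounds the number of rounds.

It remains to see that a local optimum is 3/4-PMMS (`three_mul_pmms_le`). Let τ be the smaller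
utility of the present cut of X, and suppose that 3p > 4τ for the pairwise maximin share p, attained
by P and Q. For each item v, one of P, Q avoids v, is connected and is worth more than τ. The first
cut of a sweep from v towards an item of that side is no better than τ, so X - v has a heavy
component whose complement in X, the blob of v, is worth at most τ. Blobs are laminar
(`blob_subset_erase`). The maximal ones, whose items v are called hubs, partition X, and deleting a
hub only detaches the rest of its blob. Hence a sweep between hubs a and b passes one whole blob at
a time (`rest_eq`) and cannot get stuck while the remainder is heavy (`exists_passable`). As all its
cuts are bad, the passed part jumps at some hub c, other than a and b, from at most τ to at least
u(X) - τ, so the blob of c is worth at least u(X) - 2τ (`exists_heavy_hub`). Taking for a and b the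
two heaviest hubs gives three disjoint blobs of that value. Each lies inside P or inside Q, so two
share a side, and the other side is worth at least p. Therefore 2(u(X) - 2τ) + p ≤ u(X), and u(X) ≥
2p gives 3p ≤ 4τ, a contradiction.

The program is written in a small language with bounded loops, where termination and a polynomial
time bound come for free (`exec_compile`). Only the outermost loop, over the rounds, is unbounded
and is handled through the potential (`exec_rounds`). -/

namespace ConnectedDivision

open Relation

set_option linter.unusedSectionVars false

variable {V : Type*} [DecidableEq V]

/-- `w` is a neighbour of `v` inside `M`. -/
def Within (G : SimpleGraph V) (M : Finset V) (v w : V) : Prop := G.Adj v w ∧ w ∈ M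

section Component

variable [Fintype V] {G : SimpleGraph V} {M D X : Finset V} {b x y z : V}

open Classical in
/-- The vertices reachable from `b` by walks whose vertices after `b` lie in `M`. -/
noncomputable def component (G : SimpleGraph V) (M : Finset V) (b : V) : Finset V :=
  Finset.univ.filter (ReflTransGen (Within G M) b)

theorem mem_component : x ∈ component G M b ↔ ReflTransGen (Within G M) b x := by
  simp [component]

theorem self_mem_component (b : V) : b ∈ component G M b := mem_component.2 .refl

theorem component_subset (hb : b ∈ M) : component G M b ⊆ M := by
  intro x hx
  rcases ReflTransGen.cases_tail (mem_component.1 hx) with h | ⟨y, _, h⟩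
  · rwa [h]
  · exact h.2

theorem component_closed (hx : x ∈ component G M b) (h : G.Adj x y) (hy : y ∈ M) :
    y ∈ component G M b :=
  mem_component.2 ((mem_component.1 hx).tail ⟨h, hy⟩)

theorem component_mono {M' : Finset V} (h : M ⊆ M') : component G M b ⊆ component G M' b :=
  fun _ hx => mem_component.2 (ReflTransGen.mono (fun _ _ h' => ⟨h'.1, h h'.2⟩) _ _ (mem_component.1 hx))

theorem component_trans (hx : x ∈ component G M b) : component G M x ⊆ component G M b :=
  fun _ hy => mem_component.2 ((mem_component.1 hx).trans (mem_component.1 hy))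

/-- Each step of a walk can be reversed provided that the vertex it returns to lies in M. The start
of a walk need not lie in M by definition, which is why `b ∈ M` is assumed. -/
theorem component_symm (hb : b ∈ M) (hx : x ∈ component G M b) : b ∈ component G M x := by
  have h := mem_component.1 hx
  clear hx
  induction h with
  | refl => exact self_mem_component b
  | @tail y w hy hw ih =>
    have hyM : y ∈ M := component_subset hb (mem_component.2 hy)
    exact component_trans (component_closed (self_mem_component w) hw.1.symm hyM) ih

theorem component_minimal {S : Finset V} (hb : b ∈ S)
    (hS : ∀ v ∈ S, ∀ w ∈ M, G.Adj v w → w ∈ S) : component G M b ⊆ S := by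
  intro x hx
  have h := mem_component.1 hx
  clear hx
  induction h with
  | refl => exact hb
  | tail _ hw ih => exact hS _ ih _ hw.2 hw.1

theorem connectedBundle_iff :
    ConnectedBundle G X ↔ ∀ b ∈ X, X ⊆ component G X b := by
  constructor
  · intro h b hb x hx
    have h1 := (SimpleGraph.reachable_iff_reflTransGen _ _).1 (h ⟨b, hb⟩ ⟨x, hx⟩)
    rw [mem_component]
    exact ReflTransGen.lift (r := (G.induce (X : Set V)).Adj) (p := Within G X) Subtype.val
      (fun v w hvw => ⟨hvw, w.2⟩) _ _ h1
  · rintro h ⟨b, hb⟩ ⟨x, hx⟩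
    have h1 := mem_component.1 (h b hb hx)
    induction h1 with
    | refl => exact SimpleGraph.Reachable.refl _
    | @tail y w hy hw ih =>
      have hyX : y ∈ X := component_subset hb (mem_component.2 hy)
      exact (ih hyX).trans (SimpleGraph.Adj.reachable (G := G.induce (X : Set V))
        (u := ⟨y, hyX⟩) (v := ⟨w, hx⟩) hw.1)

theorem connectedBundle_of_center (hb : b ∈ X) (h : X ⊆ component G X b) :
    ConnectedBundle G X :=
  connectedBundle_iff.2 fun _ hc => h.trans (component_trans (component_symm hb (h hc)))

theorem connectedBundle_empty : ConnectedBundle G ∅ :=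
  connectedBundle_iff.2 (by simp)

theorem connectedBundle_component : ConnectedBundle G (component G M b) := by
  refine connectedBundle_of_center (self_mem_component b) fun x hx => ?_
  have h := mem_component.1 hx
  clear hx
  induction h with
  | refl => exact self_mem_component b
  | tail hy hw ih =>
    exact component_closed ih hw.1 (mem_component.2 (hy.tail hw))

theorem ConnectedBundle.subset_component (hD : ConnectedBundle G D) (hDM : D ⊆ M) (hx : x ∈ D)
    (hxb : x ∈ component G M b) : D ⊆ component G M b :=
  (connectedBundle_iff.1 hD x hx).trans ((component_mono hDM).trans (component_trans hxb))

theorem ConnectedBundle.union {E : Finset V} (hD : ConnectedBundle G D) (hE : ConnectedBundle G E)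
    (hx : x ∈ D) (hy : y ∈ E) (h : G.Adj x y) : ConnectedBundle G (D ∪ E) := by
  refine connectedBundle_of_center (b := x) (Finset.mem_union_left _ hx)
    (Finset.union_subset ?_ ?_)
  · exact hD.subset_component Finset.subset_union_left hx (self_mem_component x)
  · exact hE.subset_component Finset.subset_union_right hy
      (component_closed (self_mem_component x) h (Finset.mem_union_right _ hy))

theorem ConnectedBundle.exists_crossing (hD : ConnectedBundle G D) {S : Finset V}
    (hx : x ∈ D) (hxS : x ∈ S) (hy : y ∈ D) (hyS : y ∉ S) :
    ∃ p ∈ D, p ∈ S ∧ ∃ q ∈ D, q ∉ S ∧ G.Adj p q := by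
  by_contra hcon
  push Not at hcon
  have : component G D x ⊆ D ∩ S := component_minimal (by simp [hx, hxS]) (by
    intro v hv w hw hvw
    rw [Finset.mem_inter] at hv ⊢
    exact ⟨hw, by_contra fun h => hcon v hv.1 hv.2 w hw h hvw⟩)
  exact hyS (Finset.mem_inter.1 (this (connectedBundle_iff.1 hD x hx hy))).2

/-- Every component of `M - z` is joined to `z`. -/
theorem ConnectedBundle.exists_adj_of_component (hM : ConnectedBundle G M) (hz : z ∈ M)
    (hb : b ∈ M) (hbz : b ≠ z) : ∃ p ∈ component G (M.erase z) b, G.Adj p z := by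
  have hbe : b ∈ M.erase z := Finset.mem_erase.2 ⟨hbz, hb⟩
  obtain ⟨p, _, hp, q, hqM, hq, hpq⟩ := hM.exists_crossing (S := component G (M.erase z) b) hb
    (self_mem_component b) hz (fun h => by simpa using component_subset hbe h)
  refine ⟨p, hp, ?_⟩
  by_cases hqz : q = z
  · rwa [← hqz]
  · exact absurd (component_closed hp hpq (Finset.mem_erase.2 ⟨hqz, hqM⟩)) hq

theorem connectedBundle_singleton (z : V) : ConnectedBundle G {z} :=
  connectedBundle_of_center (b := z) (by simp) (by simpa using self_mem_component z)

theorem ConnectedBundle.insert_component (hM : ConnectedBundle G M) (hz : z ∈ M)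
    (hb : b ∈ M) (hbz : b ≠ z) : ConnectedBundle G (insert z (component G (M.erase z) b)) := by
  obtain ⟨p, hp, hpz⟩ := hM.exists_adj_of_component hz hb hbz
  rw [Finset.insert_eq]
  exact (connectedBundle_singleton z).union
    connectedBundle_component (by simp) hp hpz.symm

theorem disjoint_component (hx : x ∉ component G M b) (hxM : x ∈ M) :
    Disjoint (component G M x) (component G M b) := by
  rw [Finset.disjoint_left]
  intro y hyx hyb
  exact hx (component_trans hyb (component_symm hxM hyx))

/-- Removing from a connected set one of the components left by `z` keeps it connected. -/
theorem ConnectedBundle.sdiff_component (hM : ConnectedBundle G M) (hz : z ∈ M)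
    (hb : b ∈ M) (hbz : b ≠ z) : ConnectedBundle G (M \ component G (M.erase z) b) := by
  have hbe : b ∈ M.erase z := Finset.mem_erase.2 ⟨hbz, hb⟩
  have hzC : z ∉ component G (M.erase z) b := fun h => by simpa using component_subset hbe h
  have hzM : z ∈ M \ component G (M.erase z) b := Finset.mem_sdiff.2 ⟨hz, hzC⟩
  refine connectedBundle_of_center hzM fun x hx => ?_
  obtain ⟨hxM, hxC⟩ := Finset.mem_sdiff.1 hx
  by_cases hxz : x = z
  · rw [hxz]; exact self_mem_component z
  have hxe : x ∈ M.erase z := Finset.mem_erase.2 ⟨hxz, hxM⟩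
  refine hM.insert_component hz hxM hxz |>.subset_component (x := z) ?_ (by simp)
    (self_mem_component z) (Finset.mem_insert_of_mem (self_mem_component x))
  refine Finset.insert_subset hzM fun y hy => Finset.mem_sdiff.2
    ⟨Finset.mem_of_mem_erase (component_subset hxe hy), ?_⟩
  exact Finset.disjoint_left.1 (disjoint_component hxC hxe) hy

end Component

/-! ### Utilities and pairwise maximin shares -/

theorem utility_mono {u : V → ℕ} {X Y : Finset V} (h : X ⊆ Y) : utility u X ≤ utility u Y :=
  Finset.sum_le_sum_of_subset h

theorem utility_union {u : V → ℕ} {X Y : Finset V} (h : Disjoint X Y) :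
    utility u (X ∪ Y) = utility u X + utility u Y :=
  Finset.sum_union h

theorem utility_sdiff_add {u : V → ℕ} {X Y : Finset V} (h : Y ⊆ X) :
    utility u (X \ Y) + utility u Y = utility u X :=
  Finset.sum_sdiff h

/-- Connectedness makes the partition into X and the empty set admissible, so the supremum is
attained and is not the default value 0. -/
theorem exists_pmms {G : SimpleGraph V} {u : V → ℕ} {X : Finset V} (hX : ConnectedBundle G X) :
    ∃ Y Z, IsConnectedBipartition G X Y Z ∧ pmms G u X = min (utility u Y) (utility u Z) := by
  have : pmms G u X ∈
      {r | ∃ Y Z, IsConnectedBipartition G X Y Z ∧ r = min (utility u Y) (utility u Z)} := by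
    refine Nat.sSup_mem ⟨_, X, ∅, ⟨by simp, by simp, hX, ?_⟩, rfl⟩ ⟨utility u X, ?_⟩
    · rintro ⟨x, hx⟩
      simp at hx
    · rintro r ⟨Y, Z, ⟨_, h, _, _⟩, rfl⟩
      exact (min_le_left _ _).trans (utility_mono (h ▸ Finset.subset_union_left))
  exact this

/-! ### Sweeps -/

section Sweep

variable [Fintype V]

/-- The value of the cut of `X` into `R` and the rest. -/
def cutValue (u : V → ℕ) (X R : Finset V) : ℕ := min (utility u R) (utility u X - utility u R)

/-- In a sweep of `X` from `a` towards `b` that has not yet passed `Z`, the item `z` may be passed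
next. -/
def Passable (G : SimpleGraph V) (X : Finset V) (a b : V) (Z : Finset V) (z : V) : Prop :=
  z ∈ Z ∧ z ≠ b ∧ (z = a ∨ ∃ y ∈ X, y ∉ Z ∧ G.Adj z y)

/-- What is left after passing `z`. -/
noncomputable def rest (G : SimpleGraph V) (b : V) (Z : Finset V) (z : V) : Finset V :=
  component G (Z.erase z) b

/-- `Z'` arises from `Z` by passing an item such that as much as possible is left. -/
def IsBestRest (G : SimpleGraph V) (X : Finset V) (a b : V) (Z Z' : Finset V) : Prop :=
  ((∀ z, ¬ Passable G X a b Z z) ∧ Z' = Z) ∨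
    ∃ z, Passable G X a b Z z ∧ Z' = rest G b Z z ∧
      ∀ w, Passable G X a b Z w → (rest G b Z w).card ≤ Z'.card

/-- `Swept G u X a b τ k Z`: some sweep of `X` from `a` towards `b` has reached `Z` after `k`
steps, and all cuts considered on the way have value at most `τ`. -/
inductive Swept (G : SimpleGraph V) (u : V → ℕ) (X : Finset V) (a b : V) (τ : ℕ) :
    ℕ → Finset V → Prop
  | start : Swept G u X a b τ 0 X
  | next {k : ℕ} {Z Z' : Finset V} : Swept G u X a b τ k Z →
      (∀ z, Passable G X a b Z z → cutValue u X (rest G b Z z) ≤ τ) →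
      IsBestRest G X a b Z Z' → Swept G u X a b τ (k + 1) Z'

variable {G : SimpleGraph V} {u : V → ℕ} {X Z : Finset V} {a b z : V} {τ : ℕ}

/-! ### Invariants of sweeps -/

theorem passable_self (ha : a ∈ X) (hab : a ≠ b) : Passable G X a b X z ↔ z = a := by
  constructor
  · rintro ⟨_, _, h | ⟨y, hy, hy', _⟩⟩
    · exact h
    · exact absurd hy hy'
  · rintro rfl
    exact ⟨ha, hab, .inl rfl⟩

/-- At the start only a can be passed, so the first step tests exactly the cut at a. This is what a
sweep reveals about the single item a. -/
theorem Swept.cutValue_le {k : ℕ} (h : Swept G u X a b τ k Z) (hk : k ≠ 0) (ha : a ∈ X)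
    (hab : a ≠ b) : cutValue u X (rest G b X a) ≤ τ := by
  induction h with
  | start => exact absurd rfl hk
  | @next k Z Z' h ht _ ih =>
    rcases Nat.eq_zero_or_pos k with rfl | hk'
    · cases h
      exact ht a ((passable_self ha hab).2 rfl)
    · exact ih hk'.ne'

/-- The invariants of a sweep that keep its cuts connected. -/
structure IsSweepCut (G : SimpleGraph V) (X : Finset V) (a b : V) (Z : Finset V) : Prop where
  subset : Z ⊆ X
  mem : b ∈ Z
  connected : ConnectedBundle G Z
  connected_sdiff : ConnectedBundle G (X \ Z)
  start : a ∈ Z → Z = X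

theorem IsSweepCut.refl (hX : ConnectedBundle G X) (hb : b ∈ X) : IsSweepCut G X a b X :=
  ⟨subset_rfl, hb, hX, by simpa using connectedBundle_empty, fun _ => rfl⟩

/-- The newly passed part is Z without one component of Z - z. It is connected because all other
components hang on z, and it is joined to the part passed before by the edge that makes z passable.
-/
theorem IsSweepCut.rest (h : IsSweepCut G X a b Z) (hz : Passable G X a b Z z) :
    IsSweepCut G X a b (rest G b Z z) := by
  obtain ⟨hzZ, hzb, hza⟩ := hz
  have hbe : b ∈ Z.erase z := Finset.mem_erase.2 ⟨hzb.symm, h.mem⟩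
  have hsub : ConnectedDivision.rest G b Z z ⊆ Z.erase z := component_subset hbe
  have hsub' := hsub.trans (Finset.erase_subset z Z)
  refine ⟨hsub'.trans h.subset, self_mem_component b, connectedBundle_component, ?_, ?_⟩
  · have hrest : ConnectedBundle G (Z \ ConnectedDivision.rest G b Z z) :=
      h.connected.sdiff_component hzZ h.mem hzb.symm
    by_cases hZX : Z = X
    · rwa [hZX] at hrest ⊢
    obtain ⟨y, hy, hyZ, hzy⟩ := hza.resolve_left fun e => hZX (h.start (e ▸ hzZ))
    have := h.connected_sdiff.union hrest (Finset.mem_sdiff.2 ⟨hy, hyZ⟩)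
      (Finset.mem_sdiff.2 ⟨hzZ, fun hz' => by simpa using hsub hz'⟩) hzy.symm
    rwa [Finset.sdiff_union_sdiff_cancel h.subset hsub'] at this
  · intro ha
    have haZ := h.start (hsub' ha)
    rcases hza with e | ⟨y, hy, hyZ, _⟩
    · exact absurd (hsub ha) (by simp [e])
    · exact absurd (haZ ▸ hy) hyZ

theorem IsSweepCut.of_isBestRest {Z' : Finset V} (h : IsSweepCut G X a b Z)
    (hZ' : IsBestRest G X a b Z Z') : IsSweepCut G X a b Z' := by
  rcases hZ' with ⟨_, rfl⟩ | ⟨z, hz, rfl, _⟩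
  · exact h
  · exact h.rest hz

theorem Swept.isSweepCut {k : ℕ} (h : Swept G u X a b τ k Z) (hX : ConnectedBundle G X)
    (hb : b ∈ X) : IsSweepCut G X a b Z := by
  induction h with
  | start => exact .refl hX hb
  | next _ _ hZ' ih => exact ih.of_isBestRest hZ'

end Sweep

end ConnectedDivision

/-! ### Sweeps find a good cut -/

namespace ConnectedDivision

set_option linter.unusedSectionVars false

variable {V : Type*} [DecidableEq V] [Fintype V]

/-- The part of `X` that is not connected to `d v` without `v`. -/
noncomputable def blob (G : SimpleGraph V) (X : Finset V) (d : V → V) (v : V) : Finset V :=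
  X \ component G (X.erase v) (d v)

/-- Every item `v` leaves a single heavy component, that of `d v`. -/
structure HasHeavyComponents (G : SimpleGraph V) (u : V → ℕ) (X : Finset V) (τ : ℕ) (d : V → V) :
    Prop where
  connected : ConnectedBundle G X
  lt_utility : 2 * τ < utility u X
  mem : ∀ v ∈ X, d v ∈ X.erase v
  blob_le : ∀ v ∈ X, utility u (blob G X d v) ≤ τ

/-- The items whose blob is maximal. -/
noncomputable def hubs (G : SimpleGraph V) (X : Finset V) (d : V → V) : Finset V :=
  X.filter fun v => ∀ w ∈ X, v ∈ blob G X d w → w = v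

namespace HasHeavyComponents

variable {G : SimpleGraph V} {u : V → ℕ} {X D Z Z' : Finset V} {τ : ℕ} {d : V → V} {a b v w x z : V}

theorem component_subset_erase (h : HasHeavyComponents G u X τ d) (hv : v ∈ X) :
    component G (X.erase v) (d v) ⊆ X.erase v :=
  component_subset (h.mem v hv)

theorem self_mem_blob (h : HasHeavyComponents G u X τ d) (hv : v ∈ X) : v ∈ blob G X d v :=
  Finset.mem_sdiff.2 ⟨hv, fun hv' => by simpa using h.component_subset_erase hv hv'⟩

/-- A connected set avoiding v lies either inside the heavy component of X - v or inside the blob of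
v, and the blob is too light for it. -/
theorem subset_component_of_lt (h : HasHeavyComponents G u X τ d) (hv : v ∈ X)
    (hD : ConnectedBundle G D) (hDX : D ⊆ X) (hvD : v ∉ D) (hu : τ < utility u D) :
    D ⊆ component G (X.erase v) (d v) := by
  by_contra hcon
  have hdis : D ⊆ blob G X d v := fun x hx => Finset.mem_sdiff.2 ⟨hDX hx, fun hxC =>
    hcon (hD.subset_component (Finset.subset_erase.2 ⟨hDX, hvD⟩) hx hxC)⟩
  have := utility_mono (u := u) hdis
  have := h.blob_le v hv
  omega

theorem lt_utility_component (h : HasHeavyComponents G u X τ d) (hv : v ∈ X) :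
    τ < utility u (component G (X.erase v) (d v)) := by
  have h1 := h.blob_le v hv
  have h2 := utility_sdiff_add (u := u)
    ((h.component_subset_erase hv).trans (Finset.erase_subset v X))
  have h3 := h.lt_utility
  unfold blob at h1
  omega

/-- Laminarity: the heavy component of v together with v is connected, heavy and avoids w, so w
cannot separate it. It therefore lies in the heavy component of w; take complements. -/
theorem blob_subset_erase (h : HasHeavyComponents G u X τ d) (hv : v ∈ X)
    (hw : w ∈ blob G X d v) (hwv : w ≠ v) : blob G X d w ⊆ (blob G X d v).erase v := by
  obtain ⟨hwX, hwC⟩ := Finset.mem_sdiff.1 hw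
  obtain ⟨hdv, hdX⟩ := Finset.mem_erase.1 (h.mem v hv)
  have hsub : insert v (component G (X.erase v) (d v)) ⊆ component G (X.erase w) (d w) := by
    refine h.subset_component_of_lt hwX (h.connected.insert_component hv hdX hdv)
      (Finset.insert_subset hv ((h.component_subset_erase hv).trans (Finset.erase_subset v X)))
      (by simp [hwv, hwC]) ((h.lt_utility_component hv).trans_le
        (utility_mono (Finset.subset_insert _ _)))
  intro x hx
  obtain ⟨hxX, hxC⟩ := Finset.mem_sdiff.1 hx
  refine Finset.mem_erase.2 ⟨?_, Finset.mem_sdiff.2 ⟨hxX, fun h' => ?_⟩⟩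
  · rintro rfl
    exact hxC (hsub (Finset.mem_insert_self _ _))
  · exact hxC (hsub (Finset.mem_insert_of_mem h'))

theorem exists_hub (h : HasHeavyComponents G u X τ d) (hx : x ∈ X) :
    ∃ v ∈ hubs G X d, x ∈ blob G X d v := by
  -- Among the blobs containing x, one with the most items belongs to a hub, since by laminarity a
  -- blob of another item containing v would be strictly larger.
  obtain ⟨v, hv, hmax⟩ := Finset.exists_max_image (X.filter fun v => x ∈ blob G X d v)
    (fun v => (blob G X d v).card) ⟨x, by simpa [hx] using h.self_mem_blob hx⟩
  obtain ⟨hvX, hxv⟩ := Finset.mem_filter.1 hv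
  refine ⟨v, Finset.mem_filter.2 ⟨hvX, fun w hw hvw => ?_⟩, hxv⟩
  by_contra hne
  have hsub := h.blob_subset_erase hw hvw (Ne.symm hne)
  have h1 := hmax w (Finset.mem_filter.2 ⟨hw, Finset.mem_of_mem_erase (hsub hxv)⟩)
  have h2 := Finset.card_le_card hsub
  have h3 := Finset.card_erase_lt_of_mem (h.self_mem_blob hw)
  omega

theorem mem_of_mem_hubs (hv : v ∈ hubs G X d) : v ∈ X := (Finset.mem_filter.1 hv).1

theorem mem_component_of_mem_hubs (hv : v ∈ hubs G X d) (hw : w ∈ X) (hvw : v ≠ w) :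
    v ∈ component G (X.erase w) (d w) := by
  by_contra hcon
  exact hvw ((Finset.mem_filter.1 hv).2 w hw
    (Finset.mem_sdiff.2 ⟨mem_of_mem_hubs hv, hcon⟩)).symm

theorem connected_blob (h : HasHeavyComponents G u X τ d) (hv : v ∈ X) :
    ConnectedBundle G (blob G X d v) :=
  h.connected.sdiff_component hv (Finset.mem_of_mem_erase (h.mem v hv))
    (Finset.ne_of_mem_erase (h.mem v hv))

/-- The blob of v is connected, avoids the hub w, and contains v, which lies in the heavy component
of w. So it lies in that component entirely. -/
theorem disjoint_blob (h : HasHeavyComponents G u X τ d) (hv : v ∈ hubs G X d)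
    (hw : w ∈ hubs G X d) (hvw : v ≠ w) : Disjoint (blob G X d v) (blob G X d w) := by
  have hvX := mem_of_mem_hubs hv
  have hwX := mem_of_mem_hubs hw
  have hwv : w ∉ blob G X d v := fun hw' =>
    (Finset.mem_sdiff.1 hw').2 (mem_component_of_mem_hubs hw hvX hvw.symm)
  have := (h.connected_blob hvX).subset_component (M := X.erase w) (b := d w)
    (Finset.subset_erase.2 ⟨Finset.sdiff_subset, hwv⟩)
    (h.self_mem_blob hvX) (mem_component_of_mem_hubs hv hwX hvw)
  exact Finset.disjoint_left.2 fun x hx hx' => (Finset.mem_sdiff.1 hx').2 (this hx)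

/-- `Z` consists of whole blobs. -/
def Saturated (G : SimpleGraph V) (X : Finset V) (d : V → V) (Z : Finset V) : Prop :=
  ∀ v ∈ hubs G X d, ∀ x ∈ blob G X d v, x ∈ Z → blob G X d v ⊆ Z

theorem saturated_sdiff (h : HasHeavyComponents G u X τ d) (hZ : Saturated G X d Z)
    (hz : z ∈ hubs G X d) : Saturated G X d (Z \ blob G X d z) := by
  intro v hv x hx hxZ
  obtain ⟨hxZ, hxz⟩ := Finset.mem_sdiff.1 hxZ
  have hvz : v ≠ z := by
    rintro rfl
    exact hxz hx
  intro y hy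
  exact Finset.mem_sdiff.2 ⟨hZ v hv x hx hxZ hy,
    Finset.disjoint_left.1 (h.disjoint_blob hv hz hvz) hy⟩

/-- Only hubs are passable. -/
theorem mem_hubs_of_adj (h : HasHeavyComponents G u X τ d) (hZ : Saturated G X d Z) (hZX : Z ⊆ X)
    (hz : z ∈ Z) {y : V} (hy : y ∈ X) (hyZ : y ∉ Z) (hzy : G.Adj z y) : z ∈ hubs G X d := by
  obtain ⟨v, hv, hzv⟩ := h.exists_hub (hZX hz)
  have hvX := mem_of_mem_hubs hv
  by_cases hvz : z = v
  · rwa [hvz]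
  exfalso
  have hyv : y ∉ blob G X d v := fun hy' => hyZ (hZ v hv z hzv hz hy')
  have hyC : y ∈ component G (X.erase v) (d v) := by
    by_contra hcon
    exact hyv (Finset.mem_sdiff.2 ⟨hy, hcon⟩)
  exact (Finset.mem_sdiff.1 hzv).2
    (component_closed hyC hzy.symm (Finset.mem_erase.2 ⟨hvz, hZX hz⟩))

/-- Passing the best item removes a single blob. -/
theorem rest_eq (h : HasHeavyComponents G u X τ d) (hb : b ∈ hubs G X d)
    (hZ : IsSweepCut G X a b Z) (hzhub : z ∈ hubs G X d)
    (hz : Passable G X a b Z z)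
    (hbest : ∀ w, Passable G X a b Z w → (rest G b Z w).card ≤ (rest G b Z z).card) :
    rest G b Z z = Z \ blob G X d z := by
  have hzZ := hz.1
  have hzb := hz.2.1
  have hzX := mem_of_mem_hubs hzhub
  have hbe : b ∈ Z.erase z := Finset.mem_erase.2 ⟨hzb.symm, hZ.mem⟩
  have hsub : rest G b Z z ⊆ Z.erase z := component_subset hbe
  have hbC : b ∈ component G (X.erase z) (d z) := mem_component_of_mem_hubs hb hzX hzb.symm
  refine Finset.Subset.antisymm (fun x hx => Finset.mem_sdiff.2
    ⟨Finset.mem_of_mem_erase (hsub hx), fun hx' => (Finset.mem_sdiff.1 hx').2 ?_⟩) ?_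
  · exact component_trans hbC (component_mono (Finset.erase_subset_erase z hZ.subset) hx)
  intro x hx
  obtain ⟨hxZ, hxH⟩ := Finset.mem_sdiff.1 hx
  by_contra hxr
  have hxz : x ≠ z := by
    rintro rfl
    exact hxH (h.self_mem_blob hzX)
  have hxe : x ∈ Z.erase z := Finset.mem_erase.2 ⟨hxz, hxZ⟩
  have hxC : x ∈ component G (X.erase z) (d z) := by
    by_contra hcon
    exact hxH (Finset.mem_sdiff.2 ⟨hZ.subset hxZ, hcon⟩)
  have hdis : Disjoint (component G (Z.erase z) x) (rest G b Z z) := disjoint_component hxr hxe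
  have hsubx : component G (Z.erase z) x ⊆ Z.erase z := component_subset hxe
  -- Suppose that x is lost with z although it is outside the blob of z. Then x and b are linked in
  -- X - z but not in Z - z, so the component of x in Z - z has an item w with a neighbour y already
  -- passed. This w is passable as well.
  obtain ⟨w, _, hw, y, hyC, hy, hwy⟩ := (connectedBundle_component (G := G) (M := X.erase z)
    (b := d z)).exists_crossing (S := component G (Z.erase z) x) hxC (self_mem_component x) hbC
    (fun hb' => Finset.disjoint_left.1 hdis hb' (self_mem_component b))
  have hyX := h.component_subset_erase hzX hyC
  have hyZ : y ∉ Z := fun hyZ => hy (component_closed hw hwy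
    (Finset.mem_erase.2 ⟨Finset.ne_of_mem_erase hyX, hyZ⟩))
  have hwZ := hsubx hw
  have hwr : w ∉ rest G b Z z := Finset.disjoint_left.1 hdis hw
  have hwb : w ≠ b := by
    rintro rfl
    exact hwr (self_mem_component w)
  have hwz : w ≠ z := Finset.ne_of_mem_erase hwZ
  have hle := hbest w ⟨Finset.mem_of_mem_erase hwZ, hwb, .inr ⟨y, Finset.mem_of_mem_erase hyX,
    hyZ, hwy⟩⟩
  -- Passing w instead would leave all that passing z leaves, and z itself, against the choice of z.
  have hlt : insert z (rest G b Z z) ⊆ rest G b Z w := by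
    refine (hZ.connected.insert_component hzZ hZ.mem hzb.symm).subset_component ?_
      (Finset.mem_insert_of_mem (self_mem_component b)) (self_mem_component b)
    refine Finset.subset_erase.2 ⟨Finset.insert_subset hzZ (hsub.trans (Finset.erase_subset z Z)),
      ?_⟩
    exact fun hw' => (Finset.mem_insert.1 hw').elim hwz hwr
  have hcard := Finset.card_le_card hlt
  rw [Finset.card_insert_of_notMem fun hz' => by simpa using hsub hz'] at hcard
  omega

/-- As long as the rest is heavy, some item is passable. -/
theorem exists_passable (h : HasHeavyComponents G u X τ d) (hb : b ∈ hubs G X d)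
    (hZ : IsSweepCut G X a b Z) (ha : a ∈ X) (haZ : a ∉ Z) (hsat : Saturated G X d Z)
    (hu : τ < utility u Z) : ∃ z, Passable G X a b Z z := by
  have hbX := mem_of_mem_hubs hb
  have hHZ := hsat b hb b (h.self_mem_blob hbX) hZ.mem
  obtain ⟨x, hxZ, hx⟩ : ∃ x ∈ Z, x ∉ blob G X d b := by
    by_contra hcon
    push Not at hcon
    have := utility_mono (u := u) (fun x hx => hcon x hx : Z ⊆ blob G X d b)
    have := h.blob_le b hbX
    omega
  -- Outside its blob, b separates nothing. The blob of b is too light to be all of Z, so some x in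
  -- Z is linked to the passed item a in X - b, and this link crosses the boundary of Z at an item
  -- other than b.
  have hC : ∀ y ∈ X, y ∉ blob G X d b → y ∈ component G (X.erase b) (d b) := by
    intro y hy hyb
    by_contra hcon
    exact hyb (Finset.mem_sdiff.2 ⟨hy, hcon⟩)
  obtain ⟨p, hpC, hp, q, hqC, hq, hpq⟩ := (connectedBundle_component (G := G) (M := X.erase b)
    (b := d b)).exists_crossing (S := Z) (hC x (hZ.subset hxZ) hx) hxZ
    (hC a ha fun h' => haZ (hHZ h')) haZ
  exact ⟨p, hp, Finset.ne_of_mem_erase (h.component_subset_erase hbX hpC), .inr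
    ⟨q, Finset.mem_of_mem_erase (h.component_subset_erase hbX hqC), hq, hpq⟩⟩

/-- A sweep between two hubs all of whose cuts are bad jumps over a third, heavy blob. -/
theorem exists_heavy_hub (h : HasHeavyComponents G u X τ d) (ha : a ∈ hubs G X d)
    (hb : b ∈ hubs G X d) (hab : a ≠ b) {n : ℕ} (hn : X.card ≤ n) (hs : Swept G u X a b τ n Z) :
    ∃ c ∈ hubs G X d, c ≠ a ∧ c ≠ b ∧ utility u X ≤ 2 * τ + utility u (blob G X d c) := by
  have haX := mem_of_mem_hubs ha
  have hbX := mem_of_mem_hubs hb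
  by_contra hcon
  push Not at hcon
  -- If no third hub is heavy enough, the passed part stays worth at most τ after every step, while
  -- each step removes at least one item. Since b always remains, this cannot go on for `X.card`
  -- steps.
  have key : ∀ k Z, Swept G u X a b τ k Z → (k = 0 ∧ Z = X) ∨ (a ∉ Z ∧ Saturated G X d Z ∧
      utility u X ≤ τ + utility u Z ∧ Z.card + k ≤ X.card) := by
    intro k Z hs
    induction hs with
    | start => exact .inl ⟨rfl, rfl⟩
    | @next k Z Z' hs ht hZ' ih =>
      right
      have hcut := hs.isSweepCut h.connected hbX
      have hsatX : Saturated G X d X := fun v _ _ _ _ => Finset.sdiff_subset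
      obtain ⟨hsat, hu, hcard, z, hz, hzZ', hbest, hzhub, haZ'⟩ : Saturated G X d Z ∧
          utility u X ≤ τ + utility u Z ∧ Z.card + k ≤ X.card ∧ ∃ z, Passable G X a b Z z ∧
          Z' = rest G b Z z ∧ (∀ w, Passable G X a b Z w → (rest G b Z w).card ≤ Z'.card) ∧
          z ∈ hubs G X d ∧ (z = a ∨ a ∉ Z) := by
        rcases ih with ⟨rfl, rfl⟩ | ⟨haZ, hsat, hu, hcard⟩
        · refine ⟨hsatX, by omega, by omega, ?_⟩
          rcases hZ' with ⟨hno, _⟩ | ⟨z, hz, hzZ', hbest⟩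
          · exact absurd ((passable_self haX hab).2 rfl) (hno a)
          · have := (passable_self haX hab).1 hz
            exact ⟨z, hz, hzZ', hbest, this ▸ ha, .inl this⟩
        · refine ⟨hsat, hu, hcard, ?_⟩
          have := h.lt_utility
          rcases hZ' with ⟨hno, _⟩ | ⟨z, hz, hzZ', hbest⟩
          · obtain ⟨z, hz⟩ := h.exists_passable hb hcut haX haZ hsat (by omega)
            exact absurd hz (hno z)
          · refine ⟨z, hz, hzZ', hbest, ?_, .inr haZ⟩
            rcases hz.2.2 with rfl | ⟨y, hy, hyZ, hzy⟩
            · exact ha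
            · exact h.mem_hubs_of_adj hsat hcut.subset hz.1 hy hyZ hzy
      subst hzZ'
      have heq := h.rest_eq hb hcut hzhub hz hbest
      have hzself := h.self_mem_blob (mem_of_mem_hubs hzhub)
      have hsub := hsat z hzhub z hzself hz.1
      have hle := ht z hz
      have h1 := utility_sdiff_add (u := u) hsub
      have h2 := Finset.card_lt_card
        (Finset.ssubset_iff_subset_ne.2 ⟨Finset.sdiff_subset (s := Z) (t := blob G X d z),
          fun e => (Finset.mem_sdiff.1 (e.symm ▸ hz.1)).2 hzself⟩)
      rw [heq] at hle ⊢
      refine ⟨?_, h.saturated_sdiff hsat hzhub, ?_, by omega⟩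
      · rcases haZ' with rfl | haZ
        · exact fun h' => (Finset.mem_sdiff.1 h').2 hzself
        · exact fun h' => haZ (Finset.mem_sdiff.1 h').1
      -- A bad cut has a side worth at most τ. If it is the remainder, the passed part has jumped:
      -- for z = a this contradicts the lightness of the blob of a, otherwise z would be the heavy
      -- third hub.
      · rcases min_le_iff.1 hle with hle | hle
        · by_cases hza : z = a
          · have := h.blob_le z (mem_of_mem_hubs hzhub)
            have := h.lt_utility
            rcases ih with ⟨rfl, rfl⟩ | ⟨haZ, _⟩
            · omega
            · exact absurd (hza ▸ hz.1) haZ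
          · have := hcon z hzhub hza hz.2.1
            omega
        · omega
  have hcut := hs.isSweepCut h.connected hbX
  have hpos := Finset.card_pos.2 ⟨b, hcut.mem⟩
  rcases key n Z hs with ⟨rfl, rfl⟩ | ⟨_, _, _, hcard⟩
  · omega
  · omega

end HasHeavyComponents

open HasHeavyComponents in
/-- If all sweeps of `X` only meet cuts of value at most `τ`, then `τ` is at least three quarters
of the pairwise maximin share. -/
theorem three_mul_pmms_le {G : SimpleGraph V} {u : V → ℕ} {X : Finset V} {τ n : ℕ}
    (hX : ConnectedBundle G X) (hn : X.card ≤ n)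
    (hs : ∀ a ∈ X, ∀ b ∈ X, a ≠ b → ∃ Z, Swept G u X a b τ n Z) :
    3 * pmms G u X ≤ 4 * τ := by
  by_contra! hlt
  obtain ⟨P, Q, ⟨hPQ, hPQX, hP, hQ⟩, hp⟩ := exists_pmms (u := u) hX
  have hPX : P ⊆ X := hPQX ▸ Finset.subset_union_left
  have hQX : Q ⊆ X := hPQX ▸ Finset.subset_union_right
  have hsum : utility u P + utility u Q = utility u X := by rw [← utility_union hPQ, hPQX]
  have hpP : pmms G u X ≤ utility u P := hp ▸ min_le_left _ _
  have hpQ : pmms G u X ≤ utility u Q := hp ▸ min_le_right _ _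
  have hne : ∀ {R : Finset V}, τ < utility u R → ∃ x, x ∈ R := by
    intro R hR
    by_contra! hcon
    rw [Finset.eq_empty_of_forall_notMem hcon] at hR
    simp [utility] at hR
  have hd : ∀ v, ∃ d, v ∈ X →
      d ∈ X.erase v ∧ utility u (X \ component G (X.erase v) d) ≤ τ := by
    intro v
    by_cases hv : v ∈ X
    swap
    · exact ⟨v, fun h => absurd h hv⟩
    -- R is the side of an optimal bipartition that avoids v. It makes the component of X - v around
    -- it heavy, so the first cut of a sweep from v can only be bad because the complement of that
    -- component is light.
    obtain ⟨R, hR, hRX, hvR, hRu⟩ : ∃ R, ConnectedBundle G R ∧ R ⊆ X ∧ v ∉ R ∧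
        pmms G u X ≤ utility u R := by
      by_cases hvP : v ∈ P
      · exact ⟨Q, hQ, hQX, Finset.disjoint_left.1 hPQ hvP, hpQ⟩
      · exact ⟨P, hP, hPX, hvP, hpP⟩
    obtain ⟨x, hx⟩ := hne (R := R) (by omega)
    have hRe : R ⊆ X.erase v := Finset.subset_erase.2 ⟨hRX, hvR⟩
    have hxe := hRe hx
    refine ⟨x, fun _ => ⟨hxe, ?_⟩⟩
    obtain ⟨Z, hZ⟩ := hs v hv x (hRX hx) (Finset.ne_of_mem_erase hxe).symm
    have hn0 : n ≠ 0 := by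
      have := Finset.card_pos.2 ⟨v, hv⟩
      omega
    have hcut := hZ.cutValue_le hn0 hv (Finset.ne_of_mem_erase hxe).symm
    have h1 := utility_mono (u := u) (hR.subset_component hRe hx (self_mem_component x))
    have h2 := utility_sdiff_add (u := u) ((component_subset (G := G) hxe).trans
      (Finset.erase_subset v X))
    rw [cutValue, ConnectedDivision.rest, min_le_iff] at hcut
    omega
  choose d hd using hd
  have h : HasHeavyComponents G u X τ d :=
    ⟨hX, by omega, fun v hv => (hd v hv).1, fun v hv => (hd v hv).2⟩
  -- There are at least two hubs: the heavy component of v is non-empty, and a hub whose blob meets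
  -- it is not v.
  have hub_ne : ∀ v ∈ X, ∃ w ∈ hubs G X d, w ≠ v := by
    intro v hv
    obtain ⟨x, hx⟩ := hne (h.lt_utility_component hv)
    have hxX := Finset.mem_of_mem_erase (h.component_subset_erase hv hx)
    obtain ⟨w, hw, hxw⟩ := h.exists_hub hxX
    refine ⟨w, hw, ?_⟩
    rintro rfl
    exact (Finset.mem_sdiff.1 hxw).2 hx
  obtain ⟨x, hx⟩ := hne (R := X) (by have := h.lt_utility; omega)
  obtain ⟨w, hw, _⟩ := h.exists_hub hx
  -- With a and b the two heaviest hubs, the lower bound for the third hub c holds for a and b too.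
  obtain ⟨a, ha, hamax⟩ := Finset.exists_max_image (hubs G X d)
    (fun v => utility u (blob G X d v)) ⟨w, hw⟩
  obtain ⟨w, hw, hwa⟩ := hub_ne a (mem_of_mem_hubs ha)
  obtain ⟨b, hb, hbmax⟩ := Finset.exists_max_image ((hubs G X d).erase a)
    (fun v => utility u (blob G X d v)) ⟨w, Finset.mem_erase.2 ⟨hwa, hw⟩⟩
  obtain ⟨hba, hb⟩ := Finset.mem_erase.1 hb
  obtain ⟨Z, hZ⟩ := hs a (mem_of_mem_hubs ha) b (mem_of_mem_hubs hb) hba.symm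
  obtain ⟨c, hc, hca, hcb, hcu⟩ := h.exists_heavy_hub ha hb hba.symm hn hZ
  have hcb' := hbmax c (Finset.mem_erase.2 ⟨hca, hc⟩)
  have hca' := hamax c hc
  -- The side that avoids v is heavy and connected, hence lies in the heavy component of v and
  -- misses the blob of v.
  have hside : ∀ v ∈ hubs G X d, (v ∈ P → blob G X d v ⊆ P) ∧ (v ∉ P → blob G X d v ⊆ Q) := by
    intro v hv
    have hvX := mem_of_mem_hubs hv
    constructor
    · intro hvP y hy
      obtain ⟨hyX, hyC⟩ := Finset.mem_sdiff.1 hy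
      have := h.subset_component_of_lt hvX hQ hQX (Finset.disjoint_left.1 hPQ hvP) (by omega)
      rw [← hPQX] at hyX
      exact (Finset.mem_union.1 hyX).resolve_right fun hyQ => hyC (this hyQ)
    · intro hvP y hy
      obtain ⟨hyX, hyC⟩ := Finset.mem_sdiff.1 hy
      have := h.subset_component_of_lt hvX hP hPX hvP (by omega)
      rw [← hPQX] at hyX
      exact (Finset.mem_union.1 hyX).resolve_left fun hyP => hyC (this hyP)
  have hpair : ∀ v ∈ hubs G X d, ∀ w ∈ hubs G X d, v ≠ w → (v ∈ P ↔ w ∈ P) →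
      utility u (blob G X d v) + utility u (blob G X d w) + pmms G u X ≤ utility u X := by
    intro v hv w hw hvw hiff
    rw [← utility_union (h.disjoint_blob hv hw hvw)]
    by_cases hvP : v ∈ P
    · have := utility_mono (u := u) (Finset.union_subset ((hside v hv).1 hvP)
        ((hside w hw).1 (hiff.1 hvP)))
      omega
    · have := utility_mono (u := u) (Finset.union_subset ((hside v hv).2 hvP)
        ((hside w hw).2 (fun h' => hvP (hiff.2 h'))))
      omega
  have h1 := hpair a ha b hb hba.symm
  have h2 := hpair a ha c hc hca.symm
  have h3 := hpair b hb c hc hcb.symm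
  -- Two of the three hubs are on the same side, and the corresponding instance of `hpair`
  -- contradicts 3p > 4τ.
  by_cases haP : a ∈ P <;> by_cases hbP : b ∈ P <;> by_cases hcP : c ∈ P <;>
    simp only [haP, hbP, hcP, iff_true, iff_self, forall_const, not_true_eq_false,
      iff_false] at h1 h2 h3 <;> omega

end ConnectedDivision

/-! ### Programs with bounded loops -/

namespace RAM

/-- Programs whose loops run through the numbers below `x₀` or below `x₁`. -/
inductive Code : Type
  | skip
  | assign (x : ℕ) (e : Term)
  | put (a : ℕ) (i e : Term)
  | seq (P Q : Code)
  | branch (e : Term) (P Q : Code)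
  /-- for `x` from `0` below the value of `x_y` -/
  | count (x y : ℕ) (P : Code)

namespace Code

/-- The machine program. -/
def compile : Code → Prog
  | skip => .skip
  | assign x e => .assign x e
  | put a i e => .put a i e
  | seq P Q => .seq P.compile Q.compile
  | branch e P Q => .branch e P.compile Q.compile
  | count x y P => .seq (.assign x (.const 0)) (.loop (.sub (.var y) (.var x))
      (.seq P.compile (.assign x (.add (.var x) (.const 1)))))

/-- A bound for the number of steps, in terms of a bound for `x₀` and `x₁`. -/
noncomputable def cost : Code → Polynomial ℕ
  | skip => 1
  | assign _ e => (e.cost + 1 : ℕ)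
  | put _ i e => (i.cost + e.cost + 1 : ℕ)
  | seq P Q => P.cost + Q.cost
  | branch e P Q => (e.cost + 1 : ℕ) + (P.cost + Q.cost)
  -- Each pass costs 4 for the test and 4 for the increment besides the body; the extra summand 1 in
  -- the first factor covers the final test, and the 2 is the initialisation.
  | count _ _ P => (Polynomial.X + 1) * (P.cost + 8) + 2

/-- Iterate `f` with the variable `x` running through the numbers below `k`. -/
def iter (f : State → State) (x : ℕ) (s : State) : ℕ → State
  | 0 => s.setVar x 0
  | k + 1 => (f (iter f x s k)).setVar x (k + 1)

/-- The final state. -/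
def run : Code → State → State
  | skip, s => s
  | assign x e, s => s.setVar x (e.eval s)
  | put a i e, s => s.setArr a (i.eval s) (e.eval s)
  | seq P Q, s => Q.run (P.run s)
  | branch e P Q, s => if e.eval s ≠ 0 then P.run s else Q.run s
  | count x y P, s => iter P.run x s (s.var y)

theorem run_seq (P Q : Code) (s : State) : (seq P Q).run s = Q.run (P.run s) := rfl

theorem run_branch (e : Term) (P Q : Code) (s : State) :
    (branch e P Q).run s = if e.eval s ≠ 0 then P.run s else Q.run s := rfl

/-- The variables that are changed. -/
def vars : Code → List ℕ
  | skip => []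
  | assign x _ => [x]
  | put _ _ _ => []
  | seq P Q => P.vars ++ Q.vars
  | branch _ P Q => P.vars ++ Q.vars
  | count x _ P => x :: P.vars

/-- The arrays that are changed. -/
def arrs : Code → List ℕ
  | skip => []
  | assign _ _ => []
  | put a _ _ => [a]
  | seq P Q => P.arrs ++ Q.arrs
  | branch _ P Q => P.arrs ++ Q.arrs
  | count _ _ P => P.arrs

/-- No loop changes its counter otherwise, and `x₀`, `x₁` are read-only. -/
def wellFormed : Code → Bool
  | skip => true
  | assign x _ => decide (2 ≤ x)
  | put _ _ _ => true
  | seq P Q => P.wellFormed && Q.wellFormed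
  | branch _ P Q => P.wellFormed && Q.wellFormed
  | count x y P => decide (2 ≤ x) && decide (y < 2) && decide (x ∉ P.vars) && P.wellFormed

/-! ### Frame lemmas: what a program leaves unchanged -/

theorem setVar_var (s : State) (x k y : ℕ) :
    (s.setVar x k).var y = if y = x then k else s.var y := by
  simp [State.setVar, Function.update_apply]

theorem setVar_arr (s : State) (x k : ℕ) : (s.setVar x k).arr = s.arr := rfl

theorem setArr_var (s : State) (a i k : ℕ) : (s.setArr a i k).var = s.var := rfl

theorem setArr_arr (s : State) (a i k b j : ℕ) :
    (s.setArr a i k).arr b j = if b = a ∧ j = i then k else s.arr b j := by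
  simp only [State.setArr, Function.update_apply]
  by_cases hb : b = a <;> by_cases hj : j = i <;> simp [hb, hj]

theorem setArr_arr_of_ne (s : State) (a i k b : ℕ) (h : b ≠ a) :
    (s.setArr a i k).arr b = s.arr b := by
  simp [State.setArr, h]

theorem iter_var {f : State → State} {x y : ℕ} {s : State} (hy : y ≠ x)
    (hf : ∀ s, (f s).var y = s.var y) (k : ℕ) : (iter f x s k).var y = s.var y := by
  induction k with
  | zero => simp [iter, setVar_var, hy]
  | succ k ih => simp [iter, setVar_var, hy, hf, ih]

theorem iter_arr {f : State → State} {x a : ℕ} {s : State}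
    (hf : ∀ s, (f s).arr a = s.arr a) (k : ℕ) : (iter f x s k).arr a = s.arr a := by
  induction k with
  | zero => rfl
  | succ k ih => simp [iter, setVar_arr, hf, ih]

theorem iter_self_var (f : State → State) (x : ℕ) (s : State) (k : ℕ) :
    (iter f x s k).var x = k := by
  cases k <;> simp [iter, setVar_var]

theorem run_var (P : Code) {y : ℕ} (h : y ∉ P.vars) (s : State) : (P.run s).var y = s.var y := by
  induction P generalizing s with
  | skip => rfl
  | assign x e =>
    have : y ≠ x := by simpa [vars] using h
    simp [run, setVar_var, this]
  | put => rfl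
  | seq P Q hP hQ =>
    simp only [vars, List.mem_append, not_or] at h
    simp [run, hP h.1, hQ h.2]
  | branch e P Q hP hQ =>
    simp only [vars, List.mem_append, not_or] at h
    unfold run
    split_ifs
    · exact hP h.1 s
    · exact hQ h.2 s
  | count x z P hP =>
    simp only [vars, List.mem_cons, not_or] at h
    exact iter_var h.1 (hP h.2) _

theorem run_arr (P : Code) {a : ℕ} (h : a ∉ P.arrs) (s : State) : (P.run s).arr a = s.arr a := by
  induction P generalizing s with
  | skip => rfl
  | assign x e => rfl
  | put b i e =>
    have : a ≠ b := by simpa [arrs] using h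
    exact setArr_arr_of_ne _ _ _ _ _ this
  | seq P Q hP hQ =>
    simp only [arrs, List.mem_append, not_or] at h
    simp [run, hP h.1, hQ h.2]
  | branch e P Q hP hQ =>
    simp only [arrs, List.mem_append, not_or] at h
    unfold run
    split_ifs
    · exact hP h.1 s
    · exact hQ h.2 s
  | count x z P hP =>
    exact iter_arr (hP h) _

/-- Loop bounds are read from `x₀` and `x₁`, so they must survive every program; this makes `count`
a true bounded loop. -/
theorem vars_ge {P : Code} (h : P.wellFormed = true) {y : ℕ} (hy : y < 2) : y ∉ P.vars := by
  induction P with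
  | skip => simp [vars]
  | assign x e =>
    simp only [wellFormed, decide_eq_true_eq] at h
    simp only [vars, List.mem_singleton]
    omega
  | put => simp [vars]
  | seq P Q hP hQ =>
    simp only [wellFormed, Bool.and_eq_true] at h
    simp [vars, hP h.1, hQ h.2]
  | branch e P Q hP hQ =>
    simp only [wellFormed, Bool.and_eq_true] at h
    simp [vars, hP h.1, hQ h.2]
  | count x z P hP =>
    simp only [wellFormed, Bool.and_eq_true, decide_eq_true_eq] at h
    simp only [vars, List.mem_cons, hP h.2, or_false]
    omega

/-- The compiled program computes `run` within the bound `cost`. -/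
theorem exec_compile (P : Code) (h : P.wellFormed = true) {N : ℕ} (s : State) (h0 : s.var 0 ≤ N)
    (h1 : s.var 1 ≤ N) : ∃ t, Exec P.compile s (P.run s) t ∧ t ≤ P.cost.eval N := by
  induction P generalizing s with
  | skip => exact ⟨_, .skip s, by simp [cost]⟩
  | assign x e => exact ⟨_, .assign x e s, by simp [cost]⟩
  | put a i e => exact ⟨_, .put a i e s, by simp [cost]⟩
  | seq P Q hP hQ =>
    simp only [wellFormed, Bool.and_eq_true] at h
    obtain ⟨t, ht, htP⟩ := hP h.1 s h0 h1
    obtain ⟨t', ht', htQ⟩ := hQ h.2 (P.run s)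
      (by rwa [run_var P (vars_ge h.1 (by simp))]) (by rwa [run_var P (vars_ge h.1 (by simp))])
    exact ⟨_, .seq ht ht', by simpa [cost] using add_le_add htP htQ⟩
  | branch e P Q hP hQ =>
    simp only [wellFormed, Bool.and_eq_true] at h
    by_cases he : e.eval s = 0
    · obtain ⟨t, ht, htQ⟩ := hQ h.2 s h0 h1
      refine ⟨_, by simpa [run, compile, he] using Exec.branchFalse he ht, ?_⟩
      simp [cost]
      omega
    · obtain ⟨t, ht, htP⟩ := hP h.1 s h0 h1
      refine ⟨_, by simpa [run, compile, he] using Exec.branchTrue he ht, ?_⟩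
      simp [cost]
      omega
  | count x y P hP =>
    simp only [wellFormed, Bool.and_eq_true, decide_eq_true_eq] at h
    obtain ⟨⟨⟨hx, hy⟩, hxP⟩, hwf⟩ := h
    have hvar : ∀ k, ∀ z < 2, (iter P.run x s k).var z = s.var z := fun k z hz =>
      iter_var (by omega) (fun s => run_var P (vars_ge hwf hz) s) k
    have hbound : s.var y ≤ N := by interval_cases y <;> assumption
    -- Induction on the number j of passes still to come, because an execution of the loop unfolds
    -- from its first pass whereas `iter` is built from its last.
    have key : ∀ j, j ≤ s.var y → ∃ t, Exec (.loop (.sub (.var y) (.var x))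
        (.seq P.compile (.assign x (.add (.var x) (.const 1))))) (iter P.run x s (s.var y - j))
        (iter P.run x s (s.var y)) t ∧ t ≤ j * (P.cost.eval N + 8) + 4 := by
      intro j
      induction j with
      | zero =>
        intro _
        refine ⟨_, .loopFalse ?_, by simp [Term.cost]⟩
        simp [Term.eval, hvar _ y hy, iter_self_var]
      | succ j ih =>
        intro hj
        obtain ⟨t, ht, htj⟩ := ih (by omega)
        obtain ⟨t', ht', htP⟩ := hP hwf (iter P.run x s (s.var y - (j + 1)))
          (by rwa [hvar _ 0 (by simp)]) (by rwa [hvar _ 1 (by simp)])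
        have heq : (P.run (iter P.run x s (s.var y - (j + 1)))).setVar x
            ((Term.add (.var x) (.const 1)).eval (P.run (iter P.run x s (s.var y - (j + 1))))) =
            iter P.run x s (s.var y - j) := by
          have e : s.var y - j = s.var y - (j + 1) + 1 := by omega
          rw [e, iter, Term.eval, Term.eval, Term.eval, run_var P hxP, iter_self_var]
        have hx' := Exec.assign x (.add (.var x) (.const 1))
          (P.run (iter P.run x s (s.var y - (j + 1))))
        rw [heq] at hx'
        refine ⟨_, .loopTrue (by simp [Term.eval, hvar _ y hy, iter_self_var]; omega)
          (.seq ht' hx') ht, ?_⟩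
        simp only [Term.cost]
        nlinarith
    obtain ⟨t, ht, htk⟩ := key (s.var y) le_rfl
    rw [Nat.sub_self] at ht
    refine ⟨_, .seq (.assign x (.const 0) s) ht, ?_⟩
    simp only [cost, Term.cost, Polynomial.eval_add, Polynomial.eval_mul, Polynomial.eval_X,
      Polynomial.eval_one, Polynomial.eval_ofNat]
    nlinarith [Nat.mul_le_mul_right (P.cost.eval N + 8) hbound]

/-- The frame of a loop together with an invariant. -/
theorem run_count_induct (x y : ℕ) (P : Code) (s : State) (I : ℕ → State → Prop)
    (h0 : I 0 (s.setVar x 0))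
    (hstep : ∀ k < s.var y, ∀ s', s'.var x = k → (∀ z ∉ (count x y P).vars, s'.var z = s.var z) →
      (∀ a ∉ (count x y P).arrs, s'.arr a = s.arr a) → I k s' →
      I (k + 1) ((P.run s').setVar x (k + 1))) :
    I (s.var y) ((count x y P).run s) := by
  have key : ∀ k ≤ s.var y, I k (iter P.run x s k) := by
    intro k
    induction k with
    | zero => exact fun _ => h0
    | succ k ih =>
      intro hk
      refine hstep k hk _ (iter_self_var _ _ _ _) ?_ ?_ (ih (by omega))
      · intro z hz
        simp only [vars, List.mem_cons, not_or] at hz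
        exact iter_var hz.1 (fun s => run_var P hz.2 s) k
      · intro a ha
        exact iter_arr (fun s => run_arr P ha s) k
  exact key _ le_rfl

end Code

/-! ### Conditions -/

namespace Term

/-- Conjunction; it is also the minimum. -/
def both (e f : Term) : Term := .sub e (.sub e f)

/-- Negation. -/
def no (e : Term) : Term := .sub (.const 1) e

/-- Inequality. -/
def differ (e f : Term) : Term := .add (.sub e f) (.sub f e)

variable {s : State} {e f : Term}

theorem eval_both : (both e f).eval s = min (e.eval s) (f.eval s) := by
  simp only [both, eval]
  omega

theorem both_ne_zero : (both e f).eval s ≠ 0 ↔ e.eval s ≠ 0 ∧ f.eval s ≠ 0 := by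
  rw [eval_both]
  omega

theorem no_ne_zero : (no e).eval s ≠ 0 ↔ e.eval s = 0 := by
  simp only [no, eval]
  omega

theorem differ_ne_zero : (differ e f).eval s ≠ 0 ↔ e.eval s ≠ f.eval s := by
  simp only [differ, eval]
  omega

theorem differ_eq_zero : (differ e f).eval s = 0 ↔ e.eval s = f.eval s := by
  simp only [differ, eval]
  omega

theorem eval_add_ne_zero : (Term.add e f).eval s ≠ 0 ↔ e.eval s ≠ 0 ∨ f.eval s ≠ 0 := by
  simp only [eval]
  omega

end Term

end RAM

/-! ### Subroutines -/

namespace ConnectedDivision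

open RAM RAM.Code RAM.Term

/-- The items at which the array `a` is not `0`. -/
def support (m : ℕ) (s : State) (a : ℕ) : Finset (Fin m) :=
  Finset.univ.filter fun v => s.arr a v ≠ 0

theorem mem_support {m : ℕ} {s : State} {a : ℕ} {v : Fin m} :
    v ∈ support m s a ↔ s.arr a v ≠ 0 := by
  simp [support]

theorem support_congr {m : ℕ} {s s' : State} {a : ℕ} (h : s'.arr a = s.arr a) :
    support m s' a = support m s a := by
  simp [support, h]

theorem support_setVar {m : ℕ} {s : State} {a x k : ℕ} :
    support m (s.setVar x k) a = support m s a := rfl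

theorem support_setArr_one {m : ℕ} {s : State} {a : ℕ} (w : Fin m) :
    support m (s.setArr a w 1) a = insert w (support m s a) := by
  ext x
  simp only [mem_support, setArr_arr, Finset.mem_insert, true_and, Fin.val_inj]
  by_cases h : x = w <;> simp [h]

/-- `a[v] := e` for all items `v`, which is called `x₉` in `e`. -/
def fill (a : ℕ) (e : Term) : Code := .count 9 0 (.put a (.var 9) e)

/-- The meaning of `e` is required in every state that differs from `s` only in the counter `x₉` and
the array being filled, because it is evaluated in the middle of the loop. -/
theorem support_fill {m a : ℕ} {e : Term} {s : State} (hm : s.var 0 = m) (S : Finset (Fin m))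
    (hS : ∀ (v : Fin m) (s' : State), s'.var 9 = v → (∀ z, z ≠ 9 → s'.var z = s.var z) →
      (∀ b, b ≠ a → s'.arr b = s.arr b) → (e.eval s' ≠ 0 ↔ v ∈ S)) :
    support m ((fill a e).run s) a = S := by
  ext v
  rw [mem_support]
  have key := run_count_induct 9 0 (.put a (.var 9) e) s
    (fun k s' => ∀ v : Fin m, (v : ℕ) < k → (s'.arr a v ≠ 0 ↔ v ∈ S)) (by simp) (by
      intro k hk s' hx hvar harr ih v hv
      rw [setVar_arr, run, setArr_arr, eval, hx]
      by_cases hvk : (v : ℕ) = k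
      · rw [if_pos ⟨rfl, hvk⟩]
        exact hS v s' (hx.trans hvk.symm) (fun z hz => hvar z (by simpa [vars] using hz))
          (fun b hb => harr b (by simpa [arrs] using hb))
      · rw [if_neg (fun h => hvk h.2)]
        exact ih v (by omega))
  exact key v (hm ▸ v.2)

/-- `x` becomes the sum of `f` over all items `v` that satisfy `e`; the item `v` is called `x₉` in
`e` and `f`. -/
def total (x : ℕ) (e f : Term) : Code :=
  .seq (.assign x (.const 0)) (.count 9 0 (.branch e (.assign x (.add (.var x) f)) .skip))

theorem total_spec {m x : ℕ} {e f : Term} {s : State} (hm : s.var 0 = m) (hx0 : x ≠ 0)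
    (hx9 : x ≠ 9) (S : Finset (Fin m)) (g : Fin m → ℕ)
    (hS : ∀ (v : Fin m) (s' : State), s'.var 9 = v → (∀ z, z ≠ 9 → z ≠ x → s'.var z = s.var z) →
      s'.arr = s.arr → (e.eval s' ≠ 0 ↔ v ∈ S) ∧ f.eval s' = g v) :
    ((total x e f).run s).var x = ∑ v ∈ S, g v := by
  have key := run_count_induct 9 0 (.branch e (.assign x (.add (.var x) f)) .skip)
    (s.setVar x 0)
    (fun k s' => s'.var x = ∑ v ∈ S.filter (fun v : Fin m => (v : ℕ) < k), g v)
    (by simp [setVar_var, hx9]) (by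
      intro k hk s' hk9 hvar harr ih
      have hkm : k < m := by simpa [setVar_var, hx0.symm, hm] using hk
      obtain ⟨h1, h2⟩ := hS ⟨k, hkm⟩ s' hk9 (fun z hz hzx => by
          rw [hvar z (by simp [vars, hz, hzx]), setVar_var, if_neg hzx])
        (funext fun b => harr b (by simp [arrs]))
      have hsplit : S.filter (fun v : Fin m => (v : ℕ) < k + 1) = if (⟨k, hkm⟩ : Fin m) ∈ S then
          insert ⟨k, hkm⟩ (S.filter (fun v : Fin m => (v : ℕ) < k)) else
            S.filter (fun v : Fin m => (v : ℕ) < k) := by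
        split_ifs with hkS
        · ext v
          simp only [Finset.mem_filter, Finset.mem_insert, Fin.ext_iff]
          constructor
          · rintro ⟨h, h'⟩
            by_cases hvk : (v : ℕ) = k
            · exact .inl hvk
            · exact .inr ⟨h, by omega⟩
          · rintro (h | ⟨h, h'⟩)
            · have : v = ⟨k, hkm⟩ := Fin.ext h
              exact ⟨this ▸ hkS, by omega⟩
            · exact ⟨h, by omega⟩
        · ext v
          simp only [Finset.mem_filter]
          refine and_congr_right fun hv => ?_
          have : (v : ℕ) ≠ k := fun h => hkS ((Fin.ext h : v = ⟨k, hkm⟩) ▸ hv)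
          omega
      rw [setVar_var, if_neg hx9, hsplit, run]
      by_cases hkS : (⟨k, hkm⟩ : Fin m) ∈ S
      · rw [if_pos (h1.2 hkS), if_pos hkS, Finset.sum_insert (by simp), run, setVar_var, if_pos rfl,
          eval, eval, ih, h2, add_comm]
      · rw [if_neg (fun h => hkS (h1.1 h)), if_neg hkS, run, ih])
  have hm' : (s.setVar x 0).var 0 = m := by simp [setVar_var, hx0.symm, hm]
  rw [hm'] at key
  rw [total, run, run, eval, key]
  refine Finset.sum_congr (Finset.filter_true_of_mem fun v _ => v.2) fun _ _ => rfl

/-- The test whether the items `x_x` and `x_y` are adjacent. -/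
def adjTest (x y : ℕ) : Term := .get 0 (.add (.get 3 (.var x)) (.var y))

/-- The read-only part of the memory. -/
structure Env (I : Instance) (s : State) : Prop where
  m : s.var 0 = I.m
  n : s.var 1 = I.n
  adj : ∀ v w : Fin I.m, s.arr 0 (v * I.m + w) ≠ 0 ↔ I.G.Adj v w
  u : ∀ v : Fin I.m, s.arr 1 v = I.u v
  row : ∀ v : Fin I.m, s.arr 3 v = v * I.m

theorem Env.congr {I : Instance} {s s' : State} (h : Env I s) (h0 : s'.var 0 = s.var 0)
    (h1 : s'.var 1 = s.var 1) (a0 : s'.arr 0 = s.arr 0) (a1 : s'.arr 1 = s.arr 1)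
    (a3 : s'.arr 3 = s.arr 3) : Env I s' :=
  ⟨h0 ▸ h.m, h1 ▸ h.n, a0 ▸ h.adj, a1 ▸ h.u, a3 ▸ h.row⟩

theorem Env.run {I : Instance} {s : State} (h : Env I s) {P : Code} (hv : 0 ∉ P.vars ∧ 1 ∉ P.vars)
    (ha : 0 ∉ P.arrs ∧ 1 ∉ P.arrs ∧ 3 ∉ P.arrs) : Env I (P.run s) :=
  h.congr (run_var P hv.1 s) (run_var P hv.2 s) (run_arr P ha.1 s) (run_arr P ha.2.1 s)
    (run_arr P ha.2.2 s)

theorem Env.adjTest_ne_zero {I : Instance} {s : State} (h : Env I s) {x y : ℕ} {v w : Fin I.m}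
    (hx : s.var x = v) (hy : s.var y = w) : (adjTest x y).eval s ≠ 0 ↔ I.G.Adj v w := by
  rw [← h.adj v w]
  simp only [adjTest, eval, hx, hy, h.row]

/-- Mark `x₁₀` in `a₇` if it is a neighbour in `a₆` of the marked item `x₉`. -/
def relax : Code :=
  .branch (both (.get 7 (.var 9)) (both (.get 6 (.var 10)) (adjTest 9 10)))
    (.put 7 (.var 10) (.const 1)) .skip

/-- Mark in `a₇` the items that can be reached from `x₅` in `a₆`. -/
def reach : Code :=
  .seq (fill 7 (no (differ (.var 9) (.var 5)))) (.count 8 0 (.count 9 0 (.count 10 0 relax)))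

section Reach

variable {I : Instance} {s : State} {b v w : Fin I.m} {M : Finset (Fin I.m)}

open Classical in
theorem relax_spec (h : Env I s) (hM : support I.m s 6 = M) (hv : s.var 9 = v) (hw : s.var 10 = w) :
    support I.m (relax.run s) 7 = if v ∈ support I.m s 7 ∧ w ∈ M ∧ I.G.Adj v w then
      insert w (support I.m s 7) else support I.m s 7 := by
  have hcond : (both (.get 7 (.var 9)) (both (.get 6 (.var 10)) (adjTest 9 10))).eval s ≠ 0 ↔
      v ∈ support I.m s 7 ∧ w ∈ M ∧ I.G.Adj v w := by
    rw [both_ne_zero, both_ne_zero, h.adjTest_ne_zero hv hw, ← hM, mem_support, mem_support, eval,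
      eval, eval, eval, hv, hw]
  rw [relax, run]
  by_cases hc : v ∈ support I.m s 7 ∧ w ∈ M ∧ I.G.Adj v w
  · rw [if_pos (hcond.2 hc), if_pos hc, run, eval, eval, hw, support_setArr_one]
  · rw [if_neg (fun h => hc (hcond.1 h)), if_neg hc, run]

theorem scan_spec (h : Env I s) (hM : support I.m s 6 = M) (hv : s.var 9 = v) :
    let S := support I.m s 7
    let S' := support I.m ((Code.count 10 0 relax).run s) 7
    S ⊆ S' ∧ (S ⊆ component I.G M b → S' ⊆ component I.G M b) ∧
      (v ∈ S → ∀ w ∈ M, I.G.Adj v w → w ∈ S') := by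
  intro S S'
  have key := run_count_induct 10 0 relax s (fun k s' => S ⊆ support I.m s' 7 ∧
      (S ⊆ component I.G M b → support I.m s' 7 ⊆ component I.G M b) ∧
      (v ∈ S → ∀ w ∈ M, (w : ℕ) < k → I.G.Adj v w → w ∈ support I.m s' 7))
    ⟨subset_rfl, id, by simp⟩ (by
      intro k hk s' hk10 hvar harr ⟨ih1, ih2, ih3⟩
      have henv : Env I s' := h.congr (hvar 0 (by decide)) (hvar 1 (by decide))
        (harr 0 (by decide)) (harr 1 (by decide)) (harr 3 (by decide))
      have hv' : s'.var 9 = v := (hvar 9 (by decide)).trans hv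
      have hM' : support I.m s' 6 = M := (support_congr (harr 6 (by decide))).trans hM
      have hspec := relax_spec (w := ⟨k, h.m ▸ hk⟩) henv hM' hv' hk10
      rw [support_setVar, hspec]
      refine ⟨?_, fun hS => ?_, fun hvS w hw hwk hvw => ?_⟩
      · split_ifs
        · exact ih1.trans (Finset.subset_insert _ _)
        · exact ih1
      · split_ifs with hc
        · exact Finset.insert_subset (component_closed (ih2 hS hc.1) hc.2.2 hc.2.1) (ih2 hS)
        · exact ih2 hS
      · by_cases hwk' : (w : ℕ) = k
        · have hw' : w = ⟨k, h.m ▸ hk⟩ := Fin.ext hwk'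
          rw [← hw', if_pos ⟨ih1 hvS, hw, hvw⟩]
          exact Finset.mem_insert_self _ _
        · have := ih3 hvS w hw (by omega) hvw
          split_ifs
          · exact Finset.mem_insert_of_mem this
          · exact this)
  exact ⟨key.1, key.2.1, fun hvS w hw hvw => key.2.2 hvS w hw (by rw [h.m]; exact w.2) hvw⟩

/-- One pass over all ordered pairs closes the marked set under a single step inside M. Marks set
earlier in the same pass may spread further, so only inclusions are claimed. -/
theorem round_spec (h : Env I s) (hM : support I.m s 6 = M) :
    let S := support I.m s 7
    let S' := support I.m ((Code.count 9 0 (.count 10 0 relax)).run s) 7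
    S ⊆ S' ∧ (S ⊆ component I.G M b → S' ⊆ component I.G M b) ∧
      ∀ v ∈ S, ∀ w ∈ M, I.G.Adj v w → w ∈ S' := by
  intro S S'
  have key := run_count_induct 9 0 (.count 10 0 relax) s (fun k s' => S ⊆ support I.m s' 7 ∧
      (S ⊆ component I.G M b → support I.m s' 7 ⊆ component I.G M b) ∧
      ∀ v ∈ S, (v : ℕ) < k → ∀ w ∈ M, I.G.Adj v w → w ∈ support I.m s' 7)
    ⟨subset_rfl, id, by simp⟩ (by
      intro k hk s' hk9 hvar harr ⟨ih1, ih2, ih3⟩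
      have henv : Env I s' := h.congr (hvar 0 (by decide)) (hvar 1 (by decide))
        (harr 0 (by decide)) (harr 1 (by decide)) (harr 3 (by decide))
      have hM' : support I.m s' 6 = M := (support_congr (harr 6 (by decide))).trans hM
      obtain ⟨h1, h2, h3⟩ := scan_spec (b := b) (v := ⟨k, h.m ▸ hk⟩) henv hM' hk9
      rw [support_setVar]
      refine ⟨ih1.trans h1, fun hS => h2 (ih2 hS), fun v hv hvk w hw hvw => ?_⟩
      by_cases hvk' : (v : ℕ) = k
      · have hv' : v = ⟨k, h.m ▸ hk⟩ := Fin.ext hvk'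
        rw [hv'] at hv hvw
        exact h3 (ih1 hv) w hw hvw
      · exact h1 (ih3 v hv (by omega) w hw hvw))
  exact ⟨key.1, key.2.1, fun v hv w hw hvw => key.2.2 v hv (by rw [h.m]; exact v.2) w hw hvw⟩

theorem reach_spec (h : Env I s) (hb : s.var 5 = b) :
    support I.m (reach.run s) 7 = component I.G (support I.m s 6) b := by
  set M := support I.m s 6 with hM
  set s₀ := (fill 7 (no (differ (.var 9) (.var 5)))).run s with hs₀
  have hinit : support I.m s₀ 7 = {b} := by
    refine support_fill h.m {b} fun v s' hv hvar _ => ?_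
    rw [no_ne_zero, differ_eq_zero, eval, eval, hv, hvar 5 (by decide), hb, Finset.mem_singleton,
      Fin.val_inj]
  have henv₀ : Env I s₀ := h.run (by decide) (by decide)
  have hM₀ : support I.m s₀ 6 = M := support_congr (run_arr _ (by decide) s)
  -- Until the marks fill the component, every round adds at least one. After m rounds there would
  -- be m + 1 marks, more than there are items.
  have key := run_count_induct 8 0 (.count 9 0 (.count 10 0 relax)) s₀
    (fun k s' => b ∈ support I.m s' 7 ∧ support I.m s' 7 ⊆ component I.G M b ∧
      (component I.G M b ⊆ support I.m s' 7 ∨ k + 1 ≤ (support I.m s' 7).card))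
    (by simp [support_setVar, hinit, self_mem_component]) (by
      intro k hk s' _ hvar harr ⟨ih1, ih2, ih3⟩
      have henv : Env I s' := henv₀.congr (hvar 0 (by decide)) (hvar 1 (by decide))
        (harr 0 (by decide)) (harr 1 (by decide)) (harr 3 (by decide))
      have hM' : support I.m s' 6 = M := (support_congr (harr 6 (by decide))).trans hM₀
      obtain ⟨h1, h2, h3⟩ := round_spec (b := b) henv hM'
      rw [support_setVar]
      refine ⟨h1 ih1, h2 ih2, ?_⟩
      rcases ih3 with ih3 | ih3
      · exact .inl (ih3.trans h1)
      by_cases heq : support I.m ((Code.count 9 0 (.count 10 0 relax)).run s') 7 =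
          support I.m s' 7
      · left
        exact component_minimal (h1 ih1) fun v hv w hw hvw => h3 v (by rwa [← heq]) w hw hvw
      · right
        have := Finset.card_lt_card (Finset.ssubset_iff_subset_ne.2 ⟨h1, fun e => heq e.symm⟩)
        omega)
  rw [henv₀.m] at key
  obtain ⟨-, h2, h3⟩ := key
  refine Finset.Subset.antisymm h2 (h3.resolve_right fun h4 => ?_)
  have := Finset.card_le_univ (support I.m
    ((Code.count 8 0 (.count 9 0 (.count 10 0 relax))).run s₀) 7)
  rw [Fintype.card_fin] at this
  omega

end Reach

end ConnectedDivision

/-! ### Allocations in memory -/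

namespace ConnectedDivision

open RAM RAM.Code RAM.Term

/-- The bundle of agent `i`. -/
def bundle (I : Instance) (s : State) (i : ℕ) : Finset (Fin I.m) :=
  Finset.univ.filter fun v => s.arr 2 v = i

theorem mem_bundle {I : Instance} {s : State} {i : ℕ} {v : Fin I.m} :
    v ∈ bundle I s i ↔ s.arr 2 v = i := by
  simp [bundle]

theorem bundle_congr {I : Instance} {s s' : State} (h : s'.arr 2 = s.arr 2) (i : ℕ) :
    bundle I s' i = bundle I s i := by
  simp [bundle, h]

theorem disjoint_bundle {I : Instance} {s : State} {i j : ℕ} (h : i ≠ j) :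
    Disjoint (bundle I s i) (bundle I s j) := by
  rw [Finset.disjoint_left]
  intro v hv hv'
  exact h ((mem_bundle.1 hv).symm.trans (mem_bundle.1 hv'))

/-- The memory holds the instance and a connected allocation. -/
structure Valid (I : Instance) (s : State) : Prop where
  env : Env I s
  lt : ∀ v : Fin I.m, s.arr 2 v < I.n
  connected : ∀ i, ConnectedBundle I.G (bundle I s i)

theorem Valid.congr {I : Instance} {s s' : State} (h : Valid I s) (henv : Env I s')
    (h2 : s'.arr 2 = s.arr 2) : Valid I s' :=
  ⟨henv, by rw [h2]; exact h.lt, fun i => by rw [bundle_congr h2]; exact h.connected i⟩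

theorem Valid.setVar {I : Instance} {s : State} (h : Valid I s) {x k : ℕ} (hx : 2 ≤ x) :
    Valid I (s.setVar x k) :=
  h.congr (h.env.congr (by rw [setVar_var, if_neg (by omega)])
    (by rw [setVar_var, if_neg (by omega)]) rfl rfl rfl) rfl

/-- The sum of the squares of the utilities of the agents. -/
def potential (I : Instance) (s : State) : ℕ :=
  ∑ i ∈ Finset.range I.n, utility I.u (bundle I s i) ^ 2

/-- Either the allocation is unchanged and `K` holds, or the potential has decreased and this has
been noted in `x₁₁`. -/
def Moves (I : Instance) (s s' : State) (K : Prop) : Prop :=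
  (s'.arr 2 = s.arr 2 ∧ s'.var 11 = s.var 11 ∧ K) ∨ (potential I s' < potential I s ∧ s'.var 11 = 1)

namespace Moves

variable {I : Instance} {s s' s'' : State} {K L N : Prop}

theorem of_eq (h2 : s'.arr 2 = s.arr 2) (h11 : s'.var 11 = s.var 11) (hK : K) : Moves I s s' K :=
  .inl ⟨h2, h11, hK⟩

theorem potential_congr (h : s'.arr 2 = s.arr 2) : potential I s' = potential I s := by
  simp [potential, bundle_congr h]

/-- Once the potential has dropped, the claims about the old allocation are void and need not be
tracked. They combine only along stretches where the allocation stays the same. -/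
theorem trans (h : Moves I s s' K) (h' : Moves I s' s'' L)
    (hN : s'.arr 2 = s.arr 2 → K → L → N) : Moves I s s'' N := by
  rcases h with ⟨h2, h11, hK⟩ | ⟨hp, h11⟩
  · rcases h' with ⟨h2', h11', hL⟩ | ⟨hp', h11'⟩
    · exact .inl ⟨h2'.trans h2, h11'.trans h11, hN h2 hK hL⟩
    · exact .inr ⟨by rwa [potential_congr h2] at hp', h11'⟩
  · rcases h' with ⟨h2', h11', hL⟩ | ⟨hp', h11'⟩
    · exact .inr ⟨by rwa [potential_congr h2'], h11'.trans h11⟩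
    · exact .inr ⟨hp'.trans hp, h11'⟩

theorem mono (h : Moves I s s' K) (hN : K → N) : Moves I s s' N :=
  h.imp (fun h => ⟨h.1, h.2.1, hN h.2.2⟩) id

theorem congr_right (h : Moves I s s' K) (h2 : s''.arr 2 = s'.arr 2)
    (h11 : s''.var 11 = s'.var 11) : Moves I s s'' K :=
  h.trans (of_eq (K := True) h2 h11 trivial) fun _ hK _ => hK

end Moves

/-! ### Exchanging two bundles -/

/-- `a₂[v] := x₂` for the items `v` of `a₄` in `a₇`, and `a₂[v] := x₃` for the others of `a₄`. -/
def recolor : Code :=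
  .count 9 0 (.branch (.get 4 (.var 9))
    (.branch (.get 7 (.var 9)) (.put 2 (.var 9) (.var 2)) (.put 2 (.var 9) (.var 3))) .skip)

open Classical in
theorem recolor_spec {m : ℕ} {s : State} (hm : s.var 0 = m) (v : Fin m) :
    (recolor.run s).arr 2 v = if v ∈ support m s 4 then
      (if v ∈ support m s 7 then s.var 2 else s.var 3) else s.arr 2 v := by
  have key := run_count_induct 9 0 (.branch (.get 4 (.var 9))
    (.branch (.get 7 (.var 9)) (.put 2 (.var 9) (.var 2)) (.put 2 (.var 9) (.var 3))) .skip) s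
    (fun k s' => ∀ v : Fin m, s'.arr 2 v = if (v : ℕ) < k ∧ v ∈ support m s 4 then
      (if v ∈ support m s 7 then s.var 2 else s.var 3) else s.arr 2 v) (by simp [setVar_arr]) (by
      intro k hk s' hk9 hvar harr ih v
      have h4 : s'.arr 4 = s.arr 4 := harr 4 (by decide)
      have h7 : s'.arr 7 = s.arr 7 := harr 7 (by decide)
      have h2 : s'.var 2 = s.var 2 := hvar 2 (by decide)
      have h3 : s'.var 3 = s.var 3 := hvar 3 (by decide)
      simp only [setVar_arr, run, eval, hk9, h4, h7, h2, h3, mem_support]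
      by_cases hvk : (v : ℕ) = k
      · have hold : s'.arr 2 k = s.arr 2 k := by simpa [hvk] using ih v
        by_cases c4 : s.arr 4 k = 0 <;> by_cases c7 : s.arr 7 k = 0 <;>
          simp [c4, c7, hvk, setArr_arr, ← hold]
      · have hlt : (v : ℕ) < k + 1 ↔ (v : ℕ) < k := by omega
        have hih := ih v
        simp only [mem_support] at hih
        by_cases c4 : s.arr 4 k = 0 <;> by_cases c7 : s.arr 7 k = 0 <;>
          simp only [c4, c7, ne_eq, not_true_eq_false, not_false_eq_true, if_true, if_false,
            setArr_arr, hvk, and_false, hlt, hih])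
  have := key v
  simpa [recolor, hm] using this

/-- At a fixed sum, raising the minimum brings the two numbers closer together. -/
theorem sq_add_sq_lt {p q r t : ℕ} (h : r + t = p + q) (hlt : min p q < min r t) :
    r ^ 2 + t ^ 2 < p ^ 2 + q ^ 2 := by
  obtain ⟨h1, h2⟩ := lt_min_iff.1 hlt
  rcases le_total p q with hpq | hpq
  · rw [min_eq_left hpq] at h1 h2
    obtain ⟨c, rfl⟩ := Nat.exists_eq_add_of_lt h1
    obtain ⟨d, rfl⟩ := Nat.exists_eq_add_of_lt h2
    obtain rfl : q = p + c + 1 + d + 1 := by omega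
    nlinarith
  · rw [min_eq_right hpq] at h1 h2
    obtain ⟨c, rfl⟩ := Nat.exists_eq_add_of_lt h1
    obtain ⟨d, rfl⟩ := Nat.exists_eq_add_of_lt h2
    obtain rfl : p = q + c + 1 + d + 1 := by omega
    nlinarith

/-- The memory during a sweep of the union `X` of the bundles of `i` and `j`. -/
structure SweepInv (I : Instance) (i j : ℕ) (a b : Fin I.m) (X : Finset (Fin I.m)) (s : State) :
    Prop where
  valid : Valid I s
  fst : s.var 2 = i
  snd : s.var 3 = j
  source : s.var 4 = a
  target : s.var 5 = b
  items : support I.m s 4 = X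
  union : bundle I s i ∪ bundle I s j = X

section Apply

variable {I : Instance} {i j : ℕ} {a b : Fin I.m} {X : Finset (Fin I.m)} {s s' : State}

theorem SweepInv.congr (h : SweepInv I i j a b X s) (henv : Env I s') (h2 : s'.var 2 = s.var 2)
    (h3 : s'.var 3 = s.var 3) (h4 : s'.var 4 = s.var 4) (h5 : s'.var 5 = s.var 5)
    (a4 : s'.arr 4 = s.arr 4) (a2 : s'.arr 2 = s.arr 2) : SweepInv I i j a b X s' :=
  ⟨h.valid.congr henv a2, h2.trans h.fst, h3.trans h.snd, h4.trans h.source, h5.trans h.target,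
    (support_congr a4).trans h.items, by rw [bundle_congr a2, bundle_congr a2]; exact h.union⟩

theorem SweepInv.run (h : SweepInv I i j a b X s) {P : Code}
    (hv : ∀ y ∈ [0, 1, 2, 3, 4, 5], y ∉ P.vars) (ha : ∀ y ∈ [0, 1, 2, 3, 4], y ∉ P.arrs) :
    SweepInv I i j a b X (P.run s) := by
  simp only [List.mem_cons, List.not_mem_nil, or_false, forall_eq_or_imp, forall_eq] at hv ha
  exact h.congr (h.valid.env.run ⟨hv.1, hv.2.1⟩ ⟨ha.1, ha.2.1, ha.2.2.2.1⟩)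
    (run_var P hv.2.2.1 s) (run_var P hv.2.2.2.1 s) (run_var P hv.2.2.2.2.1 s)
    (run_var P hv.2.2.2.2.2 s) (run_arr P ha.2.2.2.2 s) (run_arr P ha.2.2.1 s)

/-- Carry out the cut in `a₇` if this improves the allocation. -/
def improve : Code :=
  -- The truncated difference of the two cut values is non-zero exactly when the new cut is strictly
  -- better.
  .branch (.sub (both (.var 12) (.sub (.var 13) (.var 12)))
      (both (.var 14) (.sub (.var 13) (.var 14))))
    (.seq recolor (.assign 11 (.const 1))) .skip

/-- An exchange leaves the union X of the two bundles unchanged, so the sweep can simply go on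
afterwards. -/
theorem improve_spec (h : SweepInv I i j a b X s) (hi : i < I.n) (hj : j < I.n) (hij : i ≠ j)
    {R : Finset (Fin I.m)} (hR : support I.m s 7 = R) (hRX : R ⊆ X) (hRc : ConnectedBundle I.G R)
    (hRc' : ConnectedBundle I.G (X \ R)) (h12 : s.var 12 = utility I.u R)
    (h13 : s.var 13 = utility I.u X) (h14 : s.var 14 = utility I.u (bundle I s i)) :
    SweepInv I i j a b X (improve.run s) ∧ Moves I s (improve.run s)
      (cutValue I.u X R ≤ cutValue I.u X (bundle I s i)) := by
  have hcond : (Term.sub (both (.var 12) (.sub (.var 13) (.var 12)))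
      (both (.var 14) (.sub (.var 13) (.var 14)))).eval s =
      cutValue I.u X R - cutValue I.u X (bundle I s i) := by
    rw [eval, eval_both, eval_both, cutValue, cutValue]
    simp only [eval, h12, h13, h14]
  rw [improve, Code.run, hcond]
  split_ifs with hc
  swap
  · exact ⟨h, .of_eq rfl rfl (by omega)⟩
  rw [Code.run, Code.run, eval]
  set s₁ := recolor.run s with hs₁
  have hcol : ∀ v : Fin I.m, s₁.arr 2 v =
      if v ∈ X then (if v ∈ R then i else j) else s.arr 2 v := by
    intro v
    rw [hs₁, recolor_spec h.valid.env.m, h.items, hR, h.fst, h.snd]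
  have hmemX : ∀ v : Fin I.m, v ∈ X ↔ s.arr 2 v = i ∨ s.arr 2 v = j := by
    intro v
    rw [← h.union, Finset.mem_union, mem_bundle, mem_bundle]
  have hbi : bundle I s₁ i = R := by
    ext v
    rw [mem_bundle, hcol]
    have := @hRX v
    have := hmemX v
    split_ifs with h1 h2 <;> simp_all [eq_comm]
  have hbj : bundle I s₁ j = X \ R := by
    ext v
    rw [mem_bundle, hcol, Finset.mem_sdiff]
    have := hmemX v
    split_ifs with h1 h2 <;> simp_all
  have hbk : ∀ k, k ≠ i → k ≠ j → bundle I s₁ k = bundle I s k := by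
    intro k hki hkj
    ext v
    rw [mem_bundle, mem_bundle, hcol]
    have := hmemX v
    split_ifs with h1 h2
    · rcases this.1 h1 with e | e <;> simp [e, hki.symm, hkj.symm]
    · rcases this.1 h1 with e | e <;> simp [e, hki.symm, hkj.symm]
    · rfl
  have henv₁ : Env I s₁ := h.valid.env.run (by decide) (by decide)
  have hval₁ : Valid I s₁ := by
    refine ⟨henv₁, fun v => ?_, fun k => ?_⟩
    · rw [hcol]
      split_ifs
      · exact hi
      · exact hj
      · exact h.valid.lt v
    · by_cases hki : k = i
      · rwa [hki, hbi]
      by_cases hkj : k = j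
      · rwa [hkj, hbj]
      rw [hbk k hki hkj]
      exact h.valid.connected k
  have hvar : ∀ {y}, y ∉ recolor.vars → y ≠ 11 → (s₁.setVar 11 1).var y = s.var y := by
    intro y hy hy'
    rw [setVar_var, if_neg hy', hs₁, run_var _ hy]
  refine ⟨⟨hval₁.setVar (by decide), (hvar (by decide) (by decide)).trans h.fst,
    (hvar (by decide) (by decide)).trans h.snd, (hvar (by decide) (by decide)).trans h.source,
    (hvar (by decide) (by decide)).trans h.target,
    (support_congr (run_arr recolor (by decide) s)).trans h.items, ?_⟩, .inr ⟨?_, by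
      rw [setVar_var, if_pos rfl]⟩⟩
  · change bundle I s₁ i ∪ bundle I s₁ j = X
    rw [hbi, hbj, Finset.union_sdiff_of_subset hRX]
  · change potential I s₁ < potential I s
    rw [potential, potential]
    have hj' : j ∈ (Finset.range I.n).erase i := by simp [hij.symm, hj]
    rw [← Finset.add_sum_erase _ _ (Finset.mem_range.2 hi), ← Finset.add_sum_erase _ _ hj',
      ← Finset.add_sum_erase (Finset.range I.n) (fun k => utility I.u (bundle I s k) ^ 2)
        (Finset.mem_range.2 hi), ← Finset.add_sum_erase _
        (fun k => utility I.u (bundle I s k) ^ 2) hj', hbi, hbj]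
    have hothers : ∑ k ∈ ((Finset.range I.n).erase i).erase j, utility I.u (bundle I s₁ k) ^ 2 =
        ∑ k ∈ ((Finset.range I.n).erase i).erase j, utility I.u (bundle I s k) ^ 2 := by
      refine Finset.sum_congr rfl fun k hk => ?_
      simp only [Finset.mem_erase] at hk
      rw [hbk k hk.2.1 hk.1]
    have hsum := utility_union (u := I.u) (disjoint_bundle (I := I) (s := s) hij)
    rw [h.union] at hsum
    have hsum' := utility_sdiff_add (u := I.u) hRX
    have hlt : cutValue I.u X (bundle I s i) < cutValue I.u X R := by omega
    unfold cutValue at hlt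
    have := sq_add_sq_lt (p := utility I.u (bundle I s i)) (q := utility I.u (bundle I s j))
      (r := utility I.u R) (t := utility I.u (X \ R)) (by omega) (by
        rw [show utility I.u (bundle I s j) = utility I.u X - utility I.u (bundle I s i) by omega,
          show utility I.u (X \ R) = utility I.u X - utility I.u R by omega]
        exact hlt)
    omega

end Apply

end ConnectedDivision

/-! ### The sweep as a program -/

namespace ConnectedDivision

open RAM RAM.Code RAM.Term

/-- Compute in `a₇` what is left of `a₅` after passing `x₇`, and in `x₁₂`, `x₁₃`, `x₁₄` the
utilities of this set, of `a₄` and of agent `x₂`. -/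
def evaluate : Code :=
  .seq (fill 6 (both (.get 5 (.var 9)) (differ (.var 9) (.var 7))))
    (.seq reach (.seq (total 12 (.get 7 (.var 9)) (.get 1 (.var 9)))
      (.seq (total 13 (.get 4 (.var 9)) (.get 1 (.var 9)))
        (total 14 (no (differ (.get 2 (.var 9)) (.var 2))) (.get 1 (.var 9))))))

/-- Keep the set in `a₇` as `a₈` if it is larger than all earlier ones; `x₁₆` is the record. -/
def keep : Code :=
  .seq (total 15 (.get 7 (.var 9)) (.const 1))
    (.branch (.sub (.var 15) (.var 16))
      (.seq (.assign 16 (.var 15)) (fill 8 (.get 7 (.var 9)))) .skip)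

/-- Try to pass the item `x₇`. -/
def tryItem : Code := .seq evaluate (.seq improve keep)

section

variable {I : Instance} {i j : ℕ} {a b z : Fin I.m} {X Z : Finset (Fin I.m)} {s : State}

theorem total_utility (h : Env I s) {x : ℕ} (hx0 : x ≠ 0) (hx9 : x ≠ 9) {e : Term}
    {S : Finset (Fin I.m)}
    (hS : ∀ (v : Fin I.m) (s' : State), s'.var 9 = v →
      (∀ z, z ≠ 9 → z ≠ x → s'.var z = s.var z) → s'.arr = s.arr → (e.eval s' ≠ 0 ↔ v ∈ S)) :
    ((total x e (.get 1 (.var 9))).run s).var x = utility I.u S := by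
  refine total_spec h.m hx0 hx9 S I.u fun v s' hv hvar harr => ⟨hS v s' hv hvar harr, ?_⟩
  rw [eval, eval, hv, harr, h.u]

theorem evaluate_spec (h : SweepInv I i j a b X s) (hZ : support I.m s 5 = Z) (hz : s.var 7 = z) :
    SweepInv I i j a b X (evaluate.run s) ∧
      support I.m (evaluate.run s) 7 = rest I.G b Z z ∧
      (evaluate.run s).var 12 = utility I.u (rest I.G b Z z) ∧
      (evaluate.run s).var 13 = utility I.u X ∧
      (evaluate.run s).var 14 = utility I.u (bundle I s i) := by
  simp only [evaluate, Code.run]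
  set s₁ := (fill 6 (both (.get 5 (.var 9)) (differ (.var 9) (.var 7)))).run s with hs₁
  have i₁ : SweepInv I i j a b X s₁ := h.run (by decide) (by decide)
  have m₁ : support I.m s₁ 6 = Z.erase z := by
    refine support_fill h.valid.env.m _ fun v s' hv hvar harr => ?_
    rw [both_ne_zero, differ_ne_zero, eval, eval, eval, eval, hv, hvar 7 (by decide), hz,
      harr 5 (by decide), ← mem_support, hZ, Finset.mem_erase, and_comm, ne_eq, Fin.val_inj]
  have b₁ : bundle I s₁ i = bundle I s i := bundle_congr (run_arr _ (by decide) s) i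
  clear_value s₁
  set s₂ := reach.run s₁ with hs₂
  have i₂ : SweepInv I i j a b X s₂ := i₁.run (by decide) (by decide)
  have r₂ : support I.m s₂ 7 = rest I.G b Z z := by
    rw [hs₂, reach_spec i₁.valid.env i₁.target, m₁, rest]
  have b₂ : bundle I s₂ i = bundle I s i :=
    (bundle_congr (run_arr reach (by decide) s₁) i).trans b₁
  clear_value s₂
  set s₃ := (total 12 (.get 7 (.var 9)) (.get 1 (.var 9))).run s₂ with hs₃
  have i₃ : SweepInv I i j a b X s₃ := i₂.run (by decide) (by decide)
  have r₃ : support I.m s₃ 7 = rest I.G b Z z :=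
    (support_congr (run_arr _ (by decide) s₂)).trans r₂
  have b₃ : bundle I s₃ i = bundle I s i := (bundle_congr (run_arr _ (by decide) s₂) i).trans b₂
  have t₃ : s₃.var 12 = utility I.u (rest I.G b Z z) := by
    refine total_utility i₂.valid.env (by decide) (by decide) fun v s' hv _ harr => ?_
    rw [eval, eval, hv, harr, ← r₂, mem_support]
  clear_value s₃
  set s₄ := (total 13 (.get 4 (.var 9)) (.get 1 (.var 9))).run s₃ with hs₄
  have i₄ : SweepInv I i j a b X s₄ := i₃.run (by decide) (by decide)
  have r₄ : support I.m s₄ 7 = rest I.G b Z z :=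
    (support_congr (run_arr _ (by decide) s₃)).trans r₃
  have b₄ : bundle I s₄ i = bundle I s i := (bundle_congr (run_arr _ (by decide) s₃) i).trans b₃
  have t₄ : s₄.var 12 = utility I.u (rest I.G b Z z) := (run_var _ (by decide) s₃).trans t₃
  have x₄ : s₄.var 13 = utility I.u X := by
    refine total_utility i₃.valid.env (by decide) (by decide) fun v s' hv _ harr => ?_
    rw [eval, eval, hv, harr, ← i₃.items, mem_support]
  clear_value s₄
  refine ⟨i₄.run (by decide) (by decide), (support_congr (run_arr _ (by decide) s₄)).trans r₄,
    (run_var _ (by decide) s₄).trans t₄, (run_var _ (by decide) s₄).trans x₄, ?_⟩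
  rw [← b₄]
  refine total_utility i₄.valid.env (by decide) (by decide) fun v s' hv hvar harr => ?_
  rw [no_ne_zero, differ_eq_zero, eval, eval, eval, hv, harr, hvar 2 (by decide) (by decide),
    i₄.fst, mem_bundle]

theorem keep_spec (h : SweepInv I i j a b X s) {R : Finset (Fin I.m)}
    (hR : support I.m s 7 = R) :
    (s.var 16 < R.card ∧ (keep.run s).var 16 = R.card ∧ support I.m (keep.run s) 8 = R) ∨
      (R.card ≤ s.var 16 ∧ (keep.run s).var 16 = s.var 16 ∧
        support I.m (keep.run s) 8 = support I.m s 8) := by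
  simp only [keep, Code.run]
  set s₁ := (total 15 (.get 7 (.var 9)) (.const 1)).run s with hs₁
  have i₁ : SweepInv I i j a b X s₁ := h.run (by decide) (by decide)
  have r₁ : support I.m s₁ 7 = R := (support_congr (run_arr _ (by decide) s)).trans hR
  have c₁ : s₁.var 15 = R.card := by
    rw [Finset.card_eq_sum_ones]
    refine total_spec h.valid.env.m (by decide) (by decide) R _ fun v s' hv _ harr => ⟨?_, rfl⟩
    rw [eval, eval, hv, harr, ← hR, mem_support]
  have e₁ : s₁.var 16 = s.var 16 := run_var _ (by decide) s
  have k₁ : support I.m s₁ 8 = support I.m s 8 := support_congr (run_arr _ (by decide) s)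
  clear_value s₁
  have hcond : (Term.sub (.var 15) (.var 16)).eval s₁ = R.card - s.var 16 := by
    simp only [eval, c₁, e₁]
  rw [hcond]
  split_ifs with hc
  · refine .inl ⟨by omega, ?_, ?_⟩
    · rw [run_var _ (by decide), setVar_var, if_pos rfl, eval, c₁]
    · refine support_fill (by rw [setVar_var, if_neg (by decide)]; exact i₁.valid.env.m) R
        fun v s' hv _ harr => ?_
      rw [eval, eval, hv, harr 7 (by decide), setVar_arr, ← r₁, mem_support]
  · exact .inr ⟨by omega, e₁, k₁⟩

theorem tryItem_spec (h : SweepInv I i j a b X s) (hi : i < I.n) (hj : j < I.n) (hij : i ≠ j)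
    (hZ : support I.m s 5 = Z) (hz : s.var 7 = z) (hcut : IsSweepCut I.G X a b Z)
    (hpass : Passable I.G X a b Z z) :
    SweepInv I i j a b X (tryItem.run s) ∧ Moves I s (tryItem.run s)
        (cutValue I.u X (rest I.G b Z z) ≤ cutValue I.u X (bundle I s i)) ∧
      ((s.var 16 < (rest I.G b Z z).card ∧ (tryItem.run s).var 16 = (rest I.G b Z z).card ∧
          support I.m (tryItem.run s) 8 = rest I.G b Z z) ∨
        ((rest I.G b Z z).card ≤ s.var 16 ∧ (tryItem.run s).var 16 = s.var 16 ∧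
          support I.m (tryItem.run s) 8 = support I.m s 8)) := by
  simp only [tryItem, Code.run]
  obtain ⟨i₁, r₁, t₁, x₁, u₁⟩ := evaluate_spec h hZ hz
  have a₁ : (evaluate.run s).arr 2 = s.arr 2 := run_arr _ (by decide) s
  have v₁ : (evaluate.run s).var 11 = s.var 11 := run_var _ (by decide) s
  have e₁ : (evaluate.run s).var 16 = s.var 16 := run_var _ (by decide) s
  have k₁ : support I.m (evaluate.run s) 8 = support I.m s 8 :=
    support_congr (run_arr _ (by decide) s)
  generalize evaluate.run s = s₁ at *
  rw [← bundle_congr a₁] at u₁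
  have hcut' := hcut.rest hpass
  obtain ⟨i₂, m₂⟩ := improve_spec i₁ hi hj hij r₁ hcut'.subset hcut'.connected
    hcut'.connected_sdiff t₁ x₁ u₁
  have r₂ : support I.m (improve.run s₁) 7 = rest I.G b Z z :=
    (support_congr (run_arr _ (by decide) s₁)).trans r₁
  have e₂ : (improve.run s₁).var 16 = s.var 16 := (run_var _ (by decide) s₁).trans e₁
  have k₂ : support I.m (improve.run s₁) 8 = support I.m s 8 :=
    (support_congr (run_arr _ (by decide) s₁)).trans k₁
  rw [bundle_congr a₁] at m₂
  generalize improve.run s₁ = s₂ at *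
  refine ⟨i₂.run (by decide) (by decide), ?_, ?_⟩
  · exact ((Moves.of_eq (K := True) a₁ v₁ trivial).trans m₂ fun _ _ h => h).congr_right
      (run_arr _ (by decide) s₂) (run_var _ (by decide) s₂)
  · rw [← e₂, ← k₂]
    exact keep_spec i₂ r₂

/-- Try to pass the item `x₇` if that is possible. -/
def probe : Code :=
  .seq (total 17 (both (.get 4 (.var 9)) (both (no (.get 5 (.var 9))) (adjTest 7 9))) (.const 1))
    (.branch (both (.get 5 (.var 7)) (both (differ (.var 7) (.var 5))
      (.add (no (differ (.var 7) (.var 4))) (.var 17)))) tryItem .skip)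

theorem probe_spec (h : SweepInv I i j a b X s) (hi : i < I.n) (hj : j < I.n) (hij : i ≠ j)
    (hZ : support I.m s 5 = Z) (hz : s.var 7 = z) (hcut : IsSweepCut I.G X a b Z) :
    SweepInv I i j a b X (probe.run s) ∧ Moves I s (probe.run s) (Passable I.G X a b Z z →
        cutValue I.u X (rest I.G b Z z) ≤ cutValue I.u X (bundle I s i)) ∧
      ((Passable I.G X a b Z z ∧ s.var 16 < (rest I.G b Z z).card ∧
          (probe.run s).var 16 = (rest I.G b Z z).card ∧
          support I.m (probe.run s) 8 = rest I.G b Z z) ∨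
        ((Passable I.G X a b Z z → (rest I.G b Z z).card ≤ s.var 16) ∧
          (probe.run s).var 16 = s.var 16 ∧
          support I.m (probe.run s) 8 = support I.m s 8)) := by
  simp only [probe, Code.run]
  set s₁ := (total 17 (both (.get 4 (.var 9)) (both (no (.get 5 (.var 9))) (adjTest 7 9)))
    (.const 1)).run s with hs₁
  have i₁ : SweepInv I i j a b X s₁ := h.run (by decide) (by decide)
  have z₁ : support I.m s₁ 5 = Z := (support_congr (run_arr _ (by decide) s)).trans hZ
  have x₁ : s₁.var 7 = z := (run_var _ (by decide) s).trans hz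
  have e₁ : s₁.var 16 = s.var 16 := run_var _ (by decide) s
  have a₁ : s₁.arr 2 = s.arr 2 := run_arr _ (by decide) s
  have v₁ : s₁.var 11 = s.var 11 := run_var _ (by decide) s
  have k₁ : support I.m s₁ 8 = support I.m s 8 := support_congr (run_arr _ (by decide) s)
  have c₁ : s₁.var 17 ≠ 0 ↔ ∃ y ∈ X, y ∉ Z ∧ I.G.Adj z y := by
    classical
    have : s₁.var 17 = ∑ y ∈ X.filter (fun y => y ∉ Z ∧ I.G.Adj z y), 1 := by
      refine total_spec h.valid.env.m (by decide) (by decide) _ _ fun v s' hv hvar harr =>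
        ⟨?_, rfl⟩
      have henv : Env I s' := h.valid.env.congr (hvar 0 (by decide) (by decide))
        (hvar 1 (by decide) (by decide)) (by rw [harr]) (by rw [harr]) (by rw [harr])
      rw [both_ne_zero, both_ne_zero, no_ne_zero,
        henv.adjTest_ne_zero ((hvar 7 (by decide) (by decide)).trans hz) hv, eval, eval, eval, eval,
        hv, harr, Finset.mem_filter, ← h.items, ← hZ, mem_support, mem_support, not_ne_iff]
    rw [this, ← Finset.card_eq_sum_ones, Finset.card_ne_zero]
    simp [Finset.Nonempty]
  clear_value s₁
  have hcond : (both (.get 5 (.var 7)) (both (differ (.var 7) (.var 5))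
      (.add (no (differ (.var 7) (.var 4))) (.var 17)))).eval s₁ ≠ 0 ↔
      Passable I.G X a b Z z := by
    rw [both_ne_zero, both_ne_zero, differ_ne_zero, eval_add_ne_zero, no_ne_zero, differ_eq_zero]
    simp only [eval, x₁]
    rw [i₁.target, i₁.source, ← mem_support, z₁, c₁, ne_eq, Fin.val_inj, Fin.val_inj, Passable]
  by_cases hc : Passable I.G X a b Z z
  · rw [if_pos (hcond.2 hc)]
    obtain ⟨h1, h2, h3⟩ := tryItem_spec i₁ hi hj hij z₁ x₁ hcut hc
    rw [e₁, k₁] at h3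
    refine ⟨h1, (Moves.of_eq (K := True) a₁ v₁ trivial).trans h2 fun _ _ h _ => ?_,
      h3.imp (fun h => ⟨hc, h⟩) (fun h => ⟨fun _ => h.1, h.2⟩)⟩
    rwa [bundle_congr a₁] at h
  · rw [if_neg (fun h => hc (hcond.1 h))]
    exact ⟨i₁, .of_eq a₁ v₁ fun h => absurd h hc, .inr ⟨fun h => absurd h hc, e₁, k₁⟩⟩

/-- One step of a sweep. -/
def step : Code :=
  .seq (.assign 16 (.const 0)) (.seq (.count 7 0 probe)
    (.branch (.var 16) (fill 5 (.get 8 (.var 9))) .skip))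

theorem step_spec (h : SweepInv I i j a b X s) (hi : i < I.n) (hj : j < I.n) (hij : i ≠ j)
    (hZ : support I.m s 5 = Z) (hcut : IsSweepCut I.G X a b Z) :
    SweepInv I i j a b X (step.run s) ∧
      IsBestRest I.G X a b Z (support I.m (step.run s) 5) ∧
      Moves I s (step.run s) (∀ z, Passable I.G X a b Z z →
        cutValue I.u X (rest I.G b Z z) ≤ cutValue I.u X (bundle I s i)) := by
  simp only [step, run_seq, run_branch]
  set s₀ := (Code.assign 16 (.const 0)).run s with hs₀
  have i₀ : SweepInv I i j a b X s₀ := h.run (by decide) (by decide)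
  have z₀ : support I.m s₀ 5 = Z := hZ
  have a₀ : s₀.arr 2 = s.arr 2 := rfl
  have v₀ : s₀.var 11 = s.var 11 := run_var _ (by decide) s
  have e₀ : s₀.var 16 = 0 := by rw [hs₀, Code.run, setVar_var, if_pos rfl, eval]
  clear_value s₀
  -- The record `x₁₆` is 0 exactly as long as no passable item has been seen, because every
  -- remainder contains the target b and so has at least one item.
  have key := run_count_induct 7 0 probe s₀ (fun k s' => SweepInv I i j a b X s' ∧
    Moves I s s' (∀ z, Passable I.G X a b Z z → (z : ℕ) < k →
        cutValue I.u X (rest I.G b Z z) ≤ cutValue I.u X (bundle I s i)) ∧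
      ((s'.var 16 = 0 ∧ ∀ z, Passable I.G X a b Z z → ¬ (z : ℕ) < k) ∨
        ∃ z, Passable I.G X a b Z z ∧ support I.m s' 8 = rest I.G b Z z ∧
          s'.var 16 = (rest I.G b Z z).card ∧
          ∀ w, Passable I.G X a b Z w → (w : ℕ) < k →
            (rest I.G b Z w).card ≤ (rest I.G b Z z).card))
    ⟨i₀.congr (i₀.valid.setVar (by decide)).env rfl rfl rfl rfl rfl rfl,
      .of_eq a₀ v₀ (by simp), .inl ⟨e₀, by simp⟩⟩ (by
    intro k hk s' hk7 hvar harr ⟨ih1, ih2, ih3⟩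
    have hkm : k < I.m := i₀.valid.env.m ▸ hk
    have hZ' : support I.m s' 5 = Z := (support_congr (harr 5 (by decide))).trans z₀
    obtain ⟨h1, h2, h3⟩ := probe_spec (z := ⟨k, hkm⟩) ih1 hi hj hij hZ' hk7 hcut
    have hlast : ∀ z : Fin I.m, (z : ℕ) < k + 1 → z = ⟨k, hkm⟩ ∨ (z : ℕ) < k := by
      intro z hz
      by_cases hzk : (z : ℕ) = k
      · exact .inl (Fin.ext hzk)
      · exact .inr (by omega)
    refine ⟨h1.congr (h1.valid.setVar (by decide)).env rfl rfl rfl rfl rfl rfl,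
      (ih2.trans h2 fun ha hK hL z hz hzk => ?_).congr_right rfl rfl, ?_⟩
    · rcases hlast z hzk with rfl | hzk'
      · rw [← bundle_congr ha]
        exact hL hz
      · exact hK z hz hzk'
    · rw [setVar_var, if_neg (by decide), support_setVar]
      rcases h3 with ⟨hp, hlt, hv, hs⟩ | ⟨hle, hv, hs⟩
      · refine .inr ⟨_, hp, hs, hv, fun w hw hwk => ?_⟩
        rcases hlast w hwk with rfl | hwk'
        · exact le_rfl
        rcases ih3 with ⟨_, hno⟩ | ⟨z, _, _, hz, hbest⟩
        · exact absurd hwk' (hno w hw)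
        · have := hbest w hw hwk'
          omega
      · rcases ih3 with ⟨h0, hno⟩ | ⟨z, hzp, hz8, hz, hbest⟩
        · refine .inl ⟨hv.trans h0, fun w hw hwk => ?_⟩
          rcases hlast w hwk with rfl | hwk'
          · have := hle hw
            have := Finset.card_pos.2 ⟨b, self_mem_component (G := I.G) (M := Z.erase ⟨k, hkm⟩) b⟩
            rw [rest] at *
            omega
          · exact hno w hw hwk'
        · refine .inr ⟨z, hzp, hs.trans hz8, hv.trans hz, fun w hw hwk => ?_⟩
          rcases hlast w hwk with rfl | hwk'
          · exact hz ▸ hle hw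
          · exact hbest w hw hwk')
  obtain ⟨h1, h2, h3⟩ := key
  have z₁ : support I.m ((Code.count 7 0 probe).run s₀) 5 = Z :=
    (support_congr (run_arr _ (by decide) s₀)).trans z₀
  rw [i₀.valid.env.m] at h2 h3
  generalize (Code.count 7 0 probe).run s₀ = s₁ at *
  replace h2 := h2.mono fun hK z hz => hK z hz z.2
  rw [eval]
  split_ifs with hc
  · obtain ⟨z, hz, hz8, _, hbest⟩ := h3.resolve_left fun h => hc h.1
    have hfill : support I.m ((fill 5 (.get 8 (.var 9))).run s₁) 5 = rest I.G b Z z := by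
      refine support_fill h1.valid.env.m _ fun v s' hv _ harr => ?_
      rw [eval, eval, hv, harr 8 (by decide), ← hz8, mem_support]
    refine ⟨h1.run (by decide) (by decide), .inr ⟨z, hz, hfill, fun w hw => ?_⟩,
      h2.congr_right (run_arr _ (by decide) s₁) (run_var _ (by decide) s₁)⟩
    rw [hfill]
    exact hbest w hw w.2
  · refine ⟨h1, ?_, h2⟩
    rw [Code.run, z₁]
    rcases h3 with ⟨_, hno⟩ | ⟨z, _, _, hz, _⟩
    · exact .inl ⟨fun z hz => hno z hz z.2, rfl⟩
    · have := Finset.card_pos.2 ⟨b, self_mem_component (G := I.G) (M := Z.erase z) b⟩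
      rw [rest] at hz
      omega

/-- A sweep of the union of the bundles of `x₂` and `x₃` from `x₄` towards `x₅`. -/
def sweep : Code :=
  .seq (fill 4 (.add (no (differ (.get 2 (.var 9)) (.var 2)))
      (no (differ (.get 2 (.var 9)) (.var 3)))))
    (.seq (fill 6 (.get 4 (.var 9))) (.seq reach
      (.seq (total 15 (both (.get 4 (.var 9)) (no (.get 7 (.var 9)))) (.const 1))
        (.branch (both (no (.var 15)) (both (differ (.var 2) (.var 3)) (both (.get 4 (.var 4))
            (both (.get 4 (.var 5)) (differ (.var 4) (.var 5))))))
          (.seq (fill 5 (.get 4 (.var 9))) (.count 6 0 step)) .skip))))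

theorem steps_spec (h : SweepInv I i j a b X s) (hi : i < I.n) (hj : j < I.n) (hij : i ≠ j)
    (hX : ConnectedBundle I.G X) (hb : b ∈ X) :
    let s' := (Code.seq (fill 5 (.get 4 (.var 9))) (.count 6 0 step)).run s
    Valid I s' ∧ Moves I s s' (∃ Z, Swept I.G I.u X a b (cutValue I.u X (bundle I s i)) I.m Z) := by
  intro s'
  simp only [s', run_seq]
  set s₀ := (fill 5 (.get 4 (.var 9))).run s with hs₀
  have i₀ : SweepInv I i j a b X s₀ := h.run (by decide) (by decide)
  have z₀ : support I.m s₀ 5 = X := by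
    refine support_fill h.valid.env.m _ fun v s' hv _ harr => ?_
    rw [eval, eval, hv, harr 4 (by decide), ← h.items, mem_support]
  have a₀ : s₀.arr 2 = s.arr 2 := run_arr _ (by decide) s
  have v₀ : s₀.var 11 = s.var 11 := run_var _ (by decide) s
  clear_value s₀
  have key := run_count_induct 6 0 step s₀ (fun k s' => SweepInv I i j a b X s' ∧
    IsSweepCut I.G X a b (support I.m s' 5) ∧ Moves I s s'
      (Swept I.G I.u X a b (cutValue I.u X (bundle I s i)) k (support I.m s' 5)))
    ⟨i₀.congr (i₀.valid.setVar (by decide)).env rfl rfl rfl rfl rfl rfl,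
      by rw [support_setVar, z₀]; exact .refl hX hb,
      .of_eq a₀ v₀ (by rw [support_setVar, z₀]; exact .start)⟩ (by
    intro k hk s' _ _ _ ⟨ih1, ih2, ih3⟩
    obtain ⟨h1, h2, h3⟩ := step_spec ih1 hi hj hij rfl ih2
    refine ⟨h1.congr (h1.valid.setVar (by decide)).env rfl rfl rfl rfl rfl rfl,
      ih2.of_isBestRest h2, (ih3.trans h3 fun ha hK hL => ?_).congr_right rfl rfl⟩
    rw [bundle_congr ha] at hL
    exact hK.next hL h2)
  rw [i₀.valid.env.m] at key
  exact ⟨key.1.valid, key.2.2.mono fun h => ⟨_, h⟩⟩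

theorem sweep_spec (h : Valid I s) (hi : i < I.n) (hj : j < I.n) (h2 : s.var 2 = i)
    (h3 : s.var 3 = j) (h4 : s.var 4 = a) (h5 : s.var 5 = b) :
    Valid I (sweep.run s) ∧ Moves I s (sweep.run s) (i ≠ j →
      ConnectedBundle I.G (bundle I s i ∪ bundle I s j) → a ∈ bundle I s i ∪ bundle I s j →
      b ∈ bundle I s i ∪ bundle I s j → a ≠ b →
      ∃ Z, Swept I.G I.u (bundle I s i ∪ bundle I s j) a b
        (cutValue I.u (bundle I s i ∪ bundle I s j) (bundle I s i)) I.m Z) := by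
  simp only [sweep, run_seq]
  set X := bundle I s i ∪ bundle I s j with hX
  set s₁ := (fill 4 (.add (no (differ (.get 2 (.var 9)) (.var 2)))
      (no (differ (.get 2 (.var 9)) (.var 3))))).run s with hs₁
  have a₁ : s₁.arr 2 = s.arr 2 := run_arr _ (by decide) s
  have x₁ : support I.m s₁ 4 = X := by
    refine support_fill h.env.m _ fun v s' hv hvar harr => ?_
    rw [eval_add_ne_zero, no_ne_zero, no_ne_zero, differ_eq_zero, differ_eq_zero]
    simp only [eval]
    rw [hv, harr 2 (by decide), hvar 2 (by decide), hvar 3 (by decide), h2, h3, hX,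
      Finset.mem_union, mem_bundle, mem_bundle]
  have i₁ : SweepInv I i j a b X s₁ :=
    ⟨h.congr (h.env.run (by decide) (by decide)) a₁, (run_var _ (by decide) s).trans h2,
      (run_var _ (by decide) s).trans h3, (run_var _ (by decide) s).trans h4,
      (run_var _ (by decide) s).trans h5, x₁, by rw [bundle_congr a₁, bundle_congr a₁]⟩
  have v₁ : s₁.var 11 = s.var 11 := run_var _ (by decide) s
  clear_value s₁
  set s₂ := (fill 6 (.get 4 (.var 9))).run s₁ with hs₂
  have i₂ : SweepInv I i j a b X s₂ := i₁.run (by decide) (by decide)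
  have m₂ : support I.m s₂ 6 = X := by
    refine support_fill i₁.valid.env.m _ fun v s' hv _ harr => ?_
    rw [eval, eval, hv, harr 4 (by decide), ← i₁.items, mem_support]
  have a₂ : s₂.arr 2 = s.arr 2 := (run_arr _ (by decide) s₁).trans a₁
  have v₂ : s₂.var 11 = s.var 11 := (run_var _ (by decide) s₁).trans v₁
  clear_value s₂
  set s₃ := reach.run s₂ with hs₃
  have i₃ : SweepInv I i j a b X s₃ := i₂.run (by decide) (by decide)
  have r₃ : support I.m s₃ 7 = component I.G X b := by
    rw [hs₃, reach_spec i₂.valid.env i₂.target, m₂]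
  have a₃ : s₃.arr 2 = s.arr 2 := (run_arr _ (by decide) s₂).trans a₂
  have v₃ : s₃.var 11 = s.var 11 := (run_var _ (by decide) s₂).trans v₂
  clear_value s₃
  set s₄ := (total 15 (both (.get 4 (.var 9)) (no (.get 7 (.var 9)))) (.const 1)).run s₃ with hs₄
  have i₄ : SweepInv I i j a b X s₄ := i₃.run (by decide) (by decide)
  have t₄ : s₄.var 15 = (X \ component I.G X b).card := by
    rw [Finset.card_eq_sum_ones]
    refine total_spec i₃.valid.env.m (by decide) (by decide) _ _ fun v s' hv _ harr => ⟨?_, rfl⟩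
    rw [both_ne_zero, no_ne_zero]
    simp only [eval]
    rw [hv, harr, Finset.mem_sdiff, ← r₃, mem_support, ← i₃.items, mem_support, not_ne_iff]
  have a₄ : s₄.arr 2 = s.arr 2 := (run_arr _ (by decide) s₃).trans a₃
  have v₄ : s₄.var 11 = s.var 11 := (run_var _ (by decide) s₃).trans v₃
  clear_value s₄
  -- `x₁₅` counts the items of X not reachable from b, so that it vanishes exactly when b reaches
  -- all of X; for b in X this is connectedness.
  have hcond : (both (no (.var 15)) (both (differ (.var 2) (.var 3)) (both (.get 4 (.var 4))
      (both (.get 4 (.var 5)) (differ (.var 4) (.var 5)))))).eval s₄ ≠ 0 ↔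
      X ⊆ component I.G X b ∧ i ≠ j ∧ a ∈ X ∧ b ∈ X ∧ a ≠ b := by
    rw [both_ne_zero, both_ne_zero, both_ne_zero, both_ne_zero, differ_ne_zero, differ_ne_zero,
      no_ne_zero]
    simp only [eval]
    rw [i₄.source, i₄.target, i₄.fst, i₄.snd, ← mem_support, ← mem_support, i₄.items, t₄,
      Finset.card_eq_zero, Finset.sdiff_eq_empty_iff_subset, ne_eq, ne_eq, Fin.val_inj]
  by_cases hc : X ⊆ component I.G X b ∧ i ≠ j ∧ a ∈ X ∧ b ∈ X ∧ a ≠ b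
  · rw [run_branch, if_pos (hcond.2 hc)]
    obtain ⟨hXc, hij, _, hb, _⟩ := hc
    obtain ⟨h1, h2⟩ := steps_spec i₄ hi hj hij (connectedBundle_of_center hb hXc) hb
    rw [bundle_congr a₄] at h2
    exact ⟨h1, (Moves.of_eq (K := True) a₄ v₄ trivial).trans h2 fun _ _ h _ _ _ _ _ => h⟩
  · rw [run_branch, if_neg (fun h => hc (hcond.1 h))]
    exact ⟨i₄.valid, .of_eq a₄ v₄ fun hij hXc ha hb hab =>
      absurd ⟨connectedBundle_iff.1 hXc b hb, hij, ha, hb, hab⟩ hc⟩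

end

end ConnectedDivision

/-! ### The local search -/

namespace ConnectedDivision

open RAM RAM.Code RAM.Term

/-- If the agents `i` and `j` share a connected set, then some sweep of it only meets cuts that are
no better than the present one. -/
def NoBetterCut (I : Instance) (s : State) (i j : ℕ) (a b : Fin I.m) : Prop :=
  i ≠ j → ConnectedBundle I.G (bundle I s i ∪ bundle I s j) → a ∈ bundle I s i ∪ bundle I s j →
    b ∈ bundle I s i ∪ bundle I s j → a ≠ b →
    ∃ Z, Swept I.G I.u (bundle I s i ∪ bundle I s j) a b
      (cutValue I.u (bundle I s i ∪ bundle I s j) (bundle I s i)) I.m Z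

section

variable {I : Instance} {s s' : State} {i j : ℕ} {a b : Fin I.m}

theorem NoBetterCut.congr (h : NoBetterCut I s' i j a b) (h2 : s'.arr 2 = s.arr 2) :
    NoBetterCut I s i j a b := by
  rw [NoBetterCut, bundle_congr h2, bundle_congr h2] at h
  exact h

/-- `K` is proved for the state in which the body starts. If nothing has changed by then, the
allocation is still that of `s`, and `hK` carries the claim back. -/
theorem count_moves {x y : ℕ} {P : Code} (hx : 2 ≤ x) (hx11 : x ≠ 11) (h : Valid I s)
    (K : State → ℕ → Prop) (hK : ∀ {s s' : State} {k}, s'.arr 2 = s.arr 2 → K s' k → K s k)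
    (hstep : ∀ k < s.var y, ∀ s', s'.var x = k →
      (∀ z ∉ (Code.count x y P).vars, s'.var z = s.var z) → Valid I s' →
      Valid I (P.run s') ∧ Moves I s' (P.run s') (K s' k)) :
    Valid I ((Code.count x y P).run s) ∧
      Moves I s ((Code.count x y P).run s) (∀ k < s.var y, K s k) := by
  refine run_count_induct x y P s (fun k s' => Valid I s' ∧ Moves I s s' (∀ l < k, K s l))
    ⟨h.setVar hx, .of_eq rfl (by rw [setVar_var, if_neg hx11.symm]) (by simp)⟩ ?_
  intro k hk s' hk' hvar _ ⟨ih1, ih2⟩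
  obtain ⟨h1, h2⟩ := hstep k hk s' hk' hvar ih1
  refine ⟨h1.setVar hx, (ih2.trans h2 fun ha hall hlast l hl => ?_).congr_right rfl
    (by rw [setVar_var, if_neg hx11.symm])⟩
  rcases Nat.lt_succ_iff_lt_or_eq.1 hl with hl | rfl
  · exact hall l hl
  · exact hK ha hlast

/-- Sweep between all pairs of agents and all pairs of items. -/
def round : Code :=
  .seq (.assign 11 (.const 0)) (.count 2 1 (.count 3 1 (.count 4 0 (.count 5 0 sweep))))

theorem sweeps_spec (h : Valid I s) :
    let s' := (Code.count 2 1 (.count 3 1 (.count 4 0 (.count 5 0 sweep)))).run s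
    Valid I s' ∧ Moves I s s' (∀ i < I.n, ∀ j < I.n, ∀ a b, NoBetterCut I s i j a b) := by
  have key := count_moves (x := 2) (y := 1) (by decide) (by decide) h
    (fun s i => ∀ j < I.n, ∀ a b, NoBetterCut I s i j a b)
    (fun h2 hK j hj a b => (hK j hj a b).congr h2)
    (P := .count 3 1 (.count 4 0 (.count 5 0 sweep))) (by
    intro i hi s₁ hi₁ hvar₁ h₁
    have key := count_moves (x := 3) (y := 1) (by decide) (by decide) h₁
      (fun s j => ∀ a b, NoBetterCut I s i j a b) (fun h2 hK a b => (hK a b).congr h2)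
      (P := .count 4 0 (.count 5 0 sweep)) (by
      intro j hj s₂ hj₂ hvar₂ h₂
      have key := count_moves (x := 4) (y := 0) (by decide) (by decide) h₂
        (fun s k => ∀ a : Fin I.m, (a : ℕ) = k → ∀ b, NoBetterCut I s i j a b)
        (fun h2 hK a ha b => (hK a ha b).congr h2) (P := .count 5 0 sweep) (by
        intro k hk s₃ hk₃ hvar₃ h₃
        have hkm : k < I.m := h₂.env.m ▸ hk
        have key := count_moves (x := 5) (y := 0) (by decide) (by decide) h₃
          (fun s l => ∀ b : Fin I.m, (b : ℕ) = l → NoBetterCut I s i j ⟨k, hkm⟩ b)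
          (fun h2 hK b hb => (hK b hb).congr h2) (P := sweep) (by
          intro l hl s₄ hl₄ hvar₄ h₄
          obtain ⟨v1, v2⟩ := sweep_spec (i := i) (j := j) (a := ⟨k, hkm⟩)
            (b := ⟨l, h₃.env.m ▸ hl⟩) h₄ (h.env.n ▸ hi) (h₁.env.n ▸ hj)
            (by rw [hvar₄ 2 (by decide), hvar₃ 2 (by decide), hvar₂ 2 (by decide), hi₁])
            (by rw [hvar₄ 3 (by decide), hvar₃ 3 (by decide), hj₂])
            (by rw [hvar₄ 4 (by decide), hk₃]) hl₄
          refine ⟨v1, v2.mono fun hN b hb => ?_⟩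
          obtain rfl : b = ⟨l, h₃.env.m ▸ hl⟩ := Fin.ext hb
          exact hN)
        refine ⟨key.1, key.2.mono fun hN a ha b => ?_⟩
        obtain rfl : a = ⟨k, hkm⟩ := Fin.ext ha
        exact hN b (by rw [h₃.env.m]; exact b.2) b rfl)
      exact ⟨key.1, key.2.mono fun hN a b => hN a (by rw [h₂.env.m]; exact a.2) a rfl b⟩)
    exact ⟨key.1, key.2.mono fun hN j hj => hN j (by rw [h₁.env.n]; exact hj)⟩)
  exact ⟨key.1, key.2.mono fun hN i hi => hN i (by rw [h.env.n]; exact hi)⟩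

theorem round_moves (h : Valid I s) : Valid I (round.run s) ∧
    (((round.run s).var 11 = 0 ∧
        ∀ i < I.n, ∀ j < I.n, ∀ a b, NoBetterCut I (round.run s) i j a b) ∨
      potential I (round.run s) < potential I s ∧ (round.run s).var 11 = 1) := by
  obtain ⟨h1, h2⟩ := sweeps_spec (h.setVar (x := 11) (k := 0) (by decide))
  refine ⟨h1, h2.imp (fun ⟨ha, hv, hN⟩ => ⟨hv.trans ?_, fun i hi j hj a b => ?_⟩) id⟩
  · rw [setVar_var, if_pos rfl]
  · exact (hN i hi j hj a b).congr ha.symm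

/-- Repeat rounds until nothing changes. -/
theorem exec_rounds {N : ℕ} (hm : I.m ≤ N) (hn : I.n ≤ N) (p : ℕ) :
    ∀ s, Valid I s → potential I s ≤ p → s.var 11 ≠ 0 →
      ∃ s' t, Exec (.loop (.var 11) round.compile) s s' t ∧
        t ≤ (p + 1) * (round.cost.eval N + 2) + 2 ∧ Valid I s' ∧
        ∀ i < I.n, ∀ j < I.n, ∀ a b, NoBetterCut I s' i j a b := by
  induction p with
  | zero =>
    intro s h hp hs
    obtain ⟨t, ht, htN⟩ := exec_compile round (by decide) s (h.env.m ▸ hm) (h.env.n ▸ hn)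
    obtain ⟨h1, ⟨h0, hN⟩ | ⟨hlt, _⟩⟩ := round_moves h
    · refine ⟨_, _, .loopTrue hs ht (.loopFalse h0), ?_, h1, hN⟩
      simp only [Term.cost]
      omega
    · omega
  | succ p ih =>
    intro s h hp hs
    obtain ⟨t, ht, htN⟩ := exec_compile round (by decide) s (h.env.m ▸ hm) (h.env.n ▸ hn)
    obtain ⟨h1, ⟨h0, hN⟩ | ⟨hlt, h11⟩⟩ := round_moves h
    · refine ⟨_, _, .loopTrue hs ht (.loopFalse h0), ?_, h1, hN⟩
      simp only [Term.cost]
      nlinarith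
    · obtain ⟨s', t', ht', htN', hv', hN'⟩ := ih _ h1 (by omega) (by omega)
      refine ⟨s', _, .loopTrue hs ht ht', ?_, hv', hN'⟩
      simp only [Term.cost]
      nlinarith

/-! ### Output, initialisation and the bound on the potential -/

theorem Valid.isConnectedAllocation (h : Valid I s) :
    IsConnectedAllocation I.G fun i : Fin I.n => bundle I s i := by
  refine ⟨⟨fun i j hij => disjoint_bundle fun e => hij (Fin.ext e), ?_⟩, fun i => h.connected i⟩
  ext v
  simp only [Finset.mem_biUnion, Finset.mem_univ, true_and, iff_true, mem_bundle]
  exact ⟨⟨_, h.lt v⟩, rfl⟩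

/-- Adjacency of the agents, or emptiness of the first bundle, makes the union connected. Then the
sweep theorem applies with τ the value of the present cut, which is at most the utility of agent i.
-/
theorem Valid.isApproxPMMS (h : Valid I s)
    (hN : ∀ i < I.n, ∀ j < I.n, ∀ a b, NoBetterCut I s i j a b) :
    IsApproxPMMS (3 / 4) I.G I.u fun i : Fin I.n => bundle I s i := by
  intro i j hij hadj
  have hij' : (i : ℕ) ≠ j := fun e => hij (Fin.ext e)
  have hX : ConnectedBundle I.G (bundle I s i ∪ bundle I s j) := by
    rcases hadj with he | ⟨v, hv, w, hw, hvw⟩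
    · rw [show bundle I s i = ∅ from he, Finset.empty_union]
      exact h.connected j
    · exact (h.connected i).union (h.connected j) hv hw hvw
  have key := three_mul_pmms_le (u := I.u) hX
    ((Finset.card_le_univ _).trans (Fintype.card_fin _).le)
    fun a ha b hb hab => hN i i.2 j j.2 a b hij' hX ha hb hab
  have hle : cutValue I.u (bundle I s i ∪ bundle I s j) (bundle I s i) ≤
      utility I.u (bundle I s i) := min_le_left _ _
  have hnat : 3 * pmms I.G I.u (bundle I s i ∪ bundle I s j) ≤
      4 * utility I.u (bundle I s i) := by omega
  have hreal : (3 : ℝ) * pmms I.G I.u (bundle I s i ∪ bundle I s j) ≤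
      4 * utility I.u (bundle I s i) := by exact_mod_cast hnat
  linarith

/-- Write the positions of the rows of the adjacency matrix into `a₃`. -/
def prelude : Code :=
  .seq (.count 9 0 (.seq (.put 3 (.var 9) (.var 12)) (.assign 12 (.add (.var 12) (.var 0)))))
    (.assign 11 (.const 1))

theorem connectedBundle_univ {V : Type*} [Fintype V] [DecidableEq V] {G : SimpleGraph V}
    (h : G.Connected) : ConnectedBundle G Finset.univ := by
  refine connectedBundle_iff.2 fun b _ x _ => mem_component.2 ?_
  exact Relation.ReflTransGen.mono (fun _ _ h => ⟨h, Finset.mem_univ _⟩) _ _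
    ((SimpleGraph.reachable_iff_reflTransGen _ _).1 (h.preconnected b x))

theorem prelude_spec (h : I.Admissible) : Valid I (prelude.run I.input) ∧
    (prelude.run I.input).var 11 = 1 := by
  have hm : I.input.var 0 = I.m := rfl
  have key := run_count_induct 9 0 (.seq (.put 3 (.var 9) (.var 12))
    (.assign 12 (.add (.var 12) (.var 0)))) I.input
    (fun k s => s.var 12 = k * I.m ∧ ∀ l < k, s.arr 3 l = l * I.m)
    ⟨by simp [setVar_var, Instance.input], by simp⟩ (by
    intro k _ s hk hvar _ ⟨ih1, ih2⟩
    have h0 : s.var 0 = I.m := hvar 0 (by decide)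
    simp only [Code.run, eval, hk, setVar_var, setArr_var, setVar_arr, setArr_arr, ih1, h0]
    refine ⟨by simp [Nat.succ_mul], fun l hl => ?_⟩
    by_cases hlk : l = k
    · simp [hlk]
    · simp only [hlk, and_false, if_false]
      exact ih2 l (by omega))
  have harr : ∀ a, a ≠ 3 → (prelude.run I.input).arr a = I.input.arr a := fun a ha =>
    run_arr prelude (by simpa [prelude, arrs] using ha) _
  refine ⟨⟨⟨run_var prelude (by decide) _, run_var prelude (by decide) _, ?_, ?_, ?_⟩, ?_, ?_⟩, ?_⟩
  · intro v w
    rw [harr 0 (by decide)]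
    simp only [Instance.input, if_true]
    constructor
    · intro h
      -- The position in the matrix determines row and column by division with remainder, as both
      -- column indices are below m.
      obtain ⟨v', w', hadj, heq⟩ := by_contra fun hn => h (if_neg hn)
      have hpos : 0 < I.m := v.pos
      have hv : (v : ℕ) = v' := by
        have := congrArg (· / I.m) heq
        simpa [Nat.mul_comm _ I.m, Nat.mul_add_div hpos, Nat.div_eq_of_lt] using this
      have hw : (w : ℕ) = w' := by rw [hv] at heq; omega
      rwa [Fin.ext hv, Fin.ext hw]
    · intro hadj
      rw [if_pos ⟨v, w, hadj, rfl⟩]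
      exact one_ne_zero
  · intro v
    rw [harr 1 (by decide)]
    simp [Instance.input]
  · intro v
    exact key.2 v v.2
  · intro v
    rw [harr 2 (by decide)]
    exact h.1
  · intro i
    by_cases hi : i = 0
    · have : bundle I (prelude.run I.input) i = Finset.univ := by
        ext v
        rw [mem_bundle, harr 2 (by decide)]
        simp [Instance.input, hi]
      rw [this]
      exact connectedBundle_univ h.2
    · have : bundle I (prelude.run I.input) i = ∅ := by
        ext v
        rw [mem_bundle, harr 2 (by decide)]
        simp [Instance.input, Ne.symm hi]
      rw [this]
      exact connectedBundle_empty
  · rw [prelude, run_seq, Code.run, setVar_var, if_pos rfl, eval]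

/-- There are at most N agents, each with utility at most N * N (number of items times largest
utility). This is where the running time depends on the utilities themselves. -/
theorem potential_le : potential I s ≤ (I.size + I.maxUtility) ^ 5 := by
  set N := I.size + I.maxUtility with hN
  have hm : I.m ≤ N := by simp only [hN, Instance.size]; omega
  have hn : I.n ≤ N := by simp only [hN, Instance.size]; omega
  have hu : ∀ X, utility I.u X ≤ N * N := by
    intro X
    have h1 : utility I.u X ≤ X.card • I.maxUtility :=
      Finset.sum_le_card_nsmul _ _ _ fun v _ => Finset.le_sup (f := I.u) (Finset.mem_univ v)
    have h2 : X.card ≤ N := ((Finset.card_le_univ X).trans (Fintype.card_fin _).le).trans hm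
    exact h1.trans (Nat.mul_le_mul h2 (Nat.le_add_left _ _))
  calc potential I s ≤ (Finset.range I.n).card • (N * N) ^ 2 :=
        Finset.sum_le_card_nsmul _ _ _ fun i _ => Nat.pow_le_pow_left (hu _) 2
    _ ≤ N * (N * N) ^ 2 := by
        rw [Finset.card_range, smul_eq_mul]
        exact Nat.mul_le_mul_right _ hn
    _ = N ^ 5 := by ring

end

end ConnectedDivision

theorem mainTheorem5 :
    RAM.SolvableInPseudoPolyTime ConnectedDivision.Instance.Admissible
      ConnectedDivision.Instance.input ConnectedDivision.Instance.size
      ConnectedDivision.Instance.maxUtility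
      (fun I s => ∃ A : Fin I.n → Finset (Fin I.m), I.Holds s A ∧
        ConnectedDivision.IsConnectedAllocation I.G A ∧
        ConnectedDivision.IsApproxPMMS (3 / 4) I.G I.u A) := by
  -- The term `X ^ 5 + 1` bounds the number of rounds: the initial potential, plus one last round
  -- that changes nothing.
  refine ⟨.seq ConnectedDivision.prelude.compile
    (.loop (.var 11) ConnectedDivision.round.compile), ConnectedDivision.prelude.cost +
      ((Polynomial.X ^ 5 + 1) * (ConnectedDivision.round.cost + 2) + 2), fun I hI => ?_⟩
  have hm : I.m ≤ I.size + I.maxUtility := by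
    simp only [ConnectedDivision.Instance.size]
    omega
  have hn : I.n ≤ I.size + I.maxUtility := by
    simp only [ConnectedDivision.Instance.size]
    omega
  obtain ⟨t, ht, htN⟩ := RAM.Code.exec_compile ConnectedDivision.prelude (by decide)
    I.input hm hn
  obtain ⟨hvalid, h11⟩ := ConnectedDivision.prelude_spec hI
  obtain ⟨s, t', ht', htN', hs, hN⟩ := ConnectedDivision.exec_rounds hm hn _ _ hvalid
    ConnectedDivision.potential_le (by omega)
  refine ⟨s, _, .seq ht ht', ?_, _, fun i v => ConnectedDivision.mem_bundle,
    hs.isConnectedAllocation, hs.isApproxPMMS hN⟩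
  simp only [Polynomial.eval_add, Polynomial.eval_mul, Polynomial.eval_pow, Polynomial.eval_X,
    Polynomial.eval_one, Polynomial.eval_ofNat]
  exact add_le_add htN htN'
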